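/- Let $\mathbb S=\bigsqcup_{n\ge1}\mathbb S_n$ be the set of finite permutations. For $\sigma\in\mathbb S_k$, $\tau\in\mathbb S_l$ put $\sigma\oplus\tau=(\sigma_1,\dots,\sigma_k,\tau_1+k,\dots,\tau_l+k)\in\mathbb S_{k+l}$ (one-line notation). For $\psi_1,\psi_2,\ldots\in\mathbb S$ let $\bigoplus_{i=1}^\infty\psi_i$ be the bijection of $\mathbb N$ that agrees with $\psi_1\oplus\cdots\oplus\psi_b$ on the letters of the latter, for every $b$. **Projective topology.** For $\sigma\in\mathbb S_k$ let $f_\sigma:\mathbb S\to\{0,1\}$ be the indicator of the set of all $\pi\in\mathbb S_n$, $n\ge k$, whose restriction to $[k]$ is $\sigma$. Restriction may be taken in positions ($\sigma(a)<\sigma(b)\Leftrightarrow\pi(a)<\pi(b)$ for $a,b\in[k]$) or in values (delete the entries greater than $k$ from the one-line notation of $\pi$). For a bijection $\pi_\infty$ of $\mathbb N$, $f_\sigma(\pi_\infty)$ is defined in the same way. We say that $\pi_n\to\pi_\infty$ in the projective topology if $f_\sigma(\pi_n)\to f_\sigma(\pi_\infty)$ for all $\sigma\in\mathbb S$, for both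 kinds of restriction. **The queue.** Customers arrive at the points of a Poisson process with intensity $\lambda>0$ at a single server of unit speed; the system is empty at time $0$. The customers have i.i.d. pairs $(S_i,U_i)$, independent of the arrivals, where $S_i>0$ is the service time, with finite mean $\mu$, and $U_i$ is an auxiliary mark in an arbitrary measurable space (it may be trivial, or serve to randomize or to set priorities). The service discipline is arbitrary subject to the following: it is a measurable rule that assigns to the customers present at each time service rates with total $1$ whenever the system is not empty; customers not present receive no service; the rates at time $t$ depend only on the customers that have arrived by time $t$; and a customer who finds the system empty starts the rule afresh, with time counted from that arrival. A customer departs as soon as the service received equals the service time. A busy period begins with each customer who finds the system empty; $K_i$ is the number of customers in the $i$-th busy period. Let $\Pi_n\in\mathbb S_n$ be the permutation that connects the orders of the arrivals and the departures of the first $n$ customers, i.e. $\Pi_n(j)$ is the rank of the departure time of the $j$-th arriving customer among the first $n$ customers (simultaneous departures are ranked in order of arrival). **Proposition.** Suppose that $\rho:=\lambda\mu<1$. Then there is a random bijection $\Pi_\infty$ of $\mathbb N$ such that $\Pi_n\to\Pi_\infty$ almost surely in the projective topology, and there are independent and identically distributed random elements $\Psi_i$, $i\in\mathbb N$, of $\mathbb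 S$ with $|\Psi_i|=K_i$ almost surely (in particular $K_i<\infty$), where $|\psi|=n$ for $\psi\in\mathbb S_n$, such that $\Pi_\infty$ is equal in distribution to $\bigoplus_{i=1}^\infty\Psi_i$. -/

import Mathlib

open MeasureTheory ProbabilityTheory Filter Topology

noncomputable section

/-! ### Finite permutations, direct sums, the projective topology -/

/-- An element of the set `𝕊` of all finite permutations: a permutation of `n` letters with
`1 ≤ n`. The letters are numbered from `0`. -/
structure FinPerm where
  size : ℕ
  size_pos : 0 < size
  toPerm : Equiv.Perm (Fin size)

namespace FinPerm

/-- The countable set of finite permutations carries the discrete `σ`-algebra. -/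
instance : MeasurableSpace FinPerm := ⊤

/-- The direct sum `σ ⊕ τ`, in one-line notation `(σ₁, …, σ_k, τ₁ + k, …, τ_l + k)`. -/
def oplus (σ τ : FinPerm) : FinPerm where
  size := σ.size + τ.size
  size_pos := Nat.add_pos_left σ.size_pos _
  toPerm := finSumFinEquiv.permCongr (Equiv.Perm.sumCongr σ.toPerm τ.toPerm)

/-- The finite direct sum `ψ 0 ⊕ ⋯ ⊕ ψ b`. -/
def partialSum (ψ : ℕ → FinPerm) : ℕ → FinPerm
  | 0 => ψ 0
  | b + 1 => (partialSum ψ b).oplus (ψ (b + 1))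

theorem lt_size_partialSum (ψ : ℕ → FinPerm) (b : ℕ) : b < (partialSum ψ b).size := by
  induction b with
  | zero => exact (ψ 0).size_pos
  | succ b ih =>
    have h := (ψ (b + 1)).size_pos
    simp only [partialSum, oplus]
    omega

/-- The infinite direct sum `⨁ i, ψ i`, as a map on `ℕ`: the common value at `p` of all the finite
sums `ψ 0 ⊕ ⋯ ⊕ ψ b` that have more than `p` letters. The sum with `b = p` is one of them. -/
def infiniteSum (ψ : ℕ → FinPerm) (p : ℕ) : ℕ :=
  ((partialSum ψ p).toPerm ⟨p, lt_size_partialSum ψ p⟩ : ℕ)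

open Classical in
/-- `f_σ(π)` for the restriction of `π` to the first `k = |σ|` positions: it is `1` if `k ≤ |π|` and
`σ(a) < σ(b) ↔ π(a) < π(b)` for the first `k` letters `a`, `b`, and `0` otherwise. -/
def posCode (σ π : FinPerm) : ℝ :=
  if ∃ h : σ.size ≤ π.size, ∀ a b : Fin σ.size,
      σ.toPerm a < σ.toPerm b ↔ π.toPerm (Fin.castLE h a) < π.toPerm (Fin.castLE h b)
  then 1 else 0

open Classical in
/-- The continuous extension of `posCode σ` to the total order `a ≺ b ↔ π(a) < π(b)` on `ℕ`. -/
def posCodeLim (σ : FinPerm) (π : Equiv.Perm ℕ) : ℝ :=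
  if ∀ a b : Fin σ.size, σ.toPerm a < σ.toPerm b ↔ π a < π b then 1 else 0

open Classical in
/-- `f_σ(π)` for the restriction of `π` to the values `1, …, k`, with `k = |σ|`: it is `1` if
`k ≤ |π|` and deleting the larger entries from the one-line notation of `π` leaves the one-line
notation of `σ` (`a` stands before `b` in `σ` iff it does in `π`), and `0` otherwise. -/
def valCode (σ π : FinPerm) : ℝ :=
  if ∃ h : σ.size ≤ π.size, ∀ a b : Fin σ.size,
      σ.toPerm.symm a < σ.toPerm.symm b ↔
        π.toPerm.symm (Fin.castLE h a) < π.toPerm.symm (Fin.castLE h b)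
  then 1 else 0

open Classical in
/-- The continuous extension of `valCode σ` to the total order `a ≺ b ↔ π⁻¹(a) < π⁻¹(b)` on `ℕ`. -/
def valCodeLim (σ : FinPerm) (π : Equiv.Perm ℕ) : ℝ :=
  if ∀ a b : Fin σ.size, σ.toPerm.symm a < σ.toPerm.symm b ↔ π.symm a < π.symm b then 1 else 0

/-- Convergence of `π n` to `π∞` in the projective topology, i.e. in the product topology on
functions of `σ`. The restriction of a permutation to `{1, …, k}` may be taken in positions or in
values (these are exchanged by inversion); convergence is required in both senses. -/
def TendstoProjective (π : ℕ → FinPerm) (πlim : Equiv.Perm ℕ) : Prop :=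
  Tendsto (fun n => fun σ => posCode σ (π n)) atTop (𝓝 fun σ => posCodeLim σ πlim) ∧
  Tendsto (fun n => fun σ => valCode σ (π n)) atTop (𝓝 fun σ => valCodeLim σ πlim)

end FinPerm

/-- The vector of ranks of `y 0, …, y (n-1)`; ties are broken by the index. -/
def rankPerm {α : Type*} [LinearOrder α] {n : ℕ} (y : Fin n → α) : Equiv.Perm (Fin n) :=
  (Tuple.sort y)⁻¹

/-- The permutation `π_y ∘ π_x⁻¹` that connects the orders of the data `(x_i, y_i)`. -/
def connectingPerm {α β : Type*} [LinearOrder α] [LinearOrder β] {n : ℕ}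
    (x : Fin n → α) (y : Fin n → β) : Equiv.Perm (Fin n) :=
  rankPerm y * (rankPerm x)⁻¹

/-! ### Single-server queues -/

/-- The input of a queue: customer `i` has an arrival time, a service requirement, and a mark that
the server may use (a priority class, or a random number for randomized disciplines). -/
abbrev Traffic (𝓤 : Type*) := ℕ → ℝ × ℝ × 𝓤

namespace Traffic

variable {𝓤 : Type*}

def arrival (x : Traffic 𝓤) (i : ℕ) : ℝ := (x i).1

def service (x : Traffic 𝓤) (i : ℕ) : ℝ := (x i).2.1

/-- Customers are numbered in the order of their arrival, the first one comes at or after time `0`,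
only finitely many arrive in bounded time, and all service requirements are positive. -/
structure Valid (x : Traffic 𝓤) : Prop where
  arrival_nonneg : 0 ≤ x.arrival 0
  arrival_strictMono : StrictMono x.arrival
  arrival_tendsto : Tendsto x.arrival atTop atTop
  service_pos : ∀ i, 0 < x.service i

/-- The traffic consisting of customers `m, m + 1, …`, with time counted from the arrival
of customer `m`. -/
def restart (x : Traffic 𝓤) (m : ℕ) : Traffic 𝓤 :=
  fun j => (x.arrival (m + j) - x.arrival m, (x (m + j)).2)

/-- `x` and `y` have the same customers up to time `t`. -/
def AgreeUpTo (x y : Traffic 𝓤) (t : ℝ) : Prop :=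
  ∀ j, (x.arrival j ≤ t ∨ y.arrival j ≤ t) → x j = y j

end Traffic

/-- A rule that says at which rate each customer is being served at each time. -/
abbrev ServiceRates (𝓤 : Type*) := Traffic 𝓤 → ℕ → ℝ → ENNReal

namespace ServiceRates

variable {𝓤 : Type*} (r : ServiceRates 𝓤)

/-- The amount of service that customer `i` has received up to time `t`. -/
def received (x : Traffic 𝓤) (i : ℕ) (t : ℝ) : ENNReal := ∫⁻ u in Set.Iic t, r x i u

/-- The departure time of customer `i`: the first time after the arrival at which the service
requirement is fulfilled, `⊤` if there is none. -/
def departure (x : Traffic 𝓤) (i : ℕ) : EReal :=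
  sInf ((fun t : ℝ => (t : EReal)) ''
    {t : ℝ | x.arrival i ≤ t ∧ ENNReal.ofReal (x.service i) ≤ r.received x i t})

/-- Customer `i` is in the system at time `t`. -/
def InSystem (x : Traffic 𝓤) (i : ℕ) (t : ℝ) : Prop :=
  x.arrival i ≤ t ∧ (t : EReal) < r.departure x i

/-- Customer `m` opens a busy period: no earlier customer is present when `m` arrives. -/
def OpensBusyPeriod (x : Traffic 𝓤) (m : ℕ) : Prop :=
  ∀ i < m, ¬ r.InSystem x i (x.arrival m)

open Classical in
/-- The number (counted from `0`) of the busy period to which customer `j` belongs. -/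
def busyIndex (x : Traffic 𝓤) (j : ℕ) : ℕ :=
  ((Finset.Icc 1 j).filter fun m => r.OpensBusyPeriod x m).card

/-- The number of customers in busy period `i` (counted from `0`). -/
def busyCount (x : Traffic 𝓤) (i : ℕ) : ℕ∞ := {j | r.busyIndex x j = i}.encard

/-- The permutation in `𝕊_{n+1}` that connects the orders of the arrivals and of the departures of
the first `n + 1` customers. -/
def queuePerm (x : Traffic 𝓤) (n : ℕ) : FinPerm where
  size := n + 1
  size_pos := n.succ_pos
  toPerm := connectingPerm (fun i : Fin (n + 1) => x.arrival i)
    (fun i : Fin (n + 1) => r.departure x i)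

end ServiceRates

/-- A work-conserving, non-anticipating service discipline for a single server of unit speed that
treats all busy periods by the same rule. First-come-first-served, last-come-first-served
(preemptive or not), processor sharing, shortest job first, and service in random order
(through the marks) are of this kind. -/
structure IsDiscipline {𝓤 : Type*} [MeasurableSpace 𝓤] (r : ServiceRates 𝓤) : Prop where
  measurable : ∀ i, Measurable fun p : Traffic 𝓤 × ℝ => r p.1 i p.2
  /-- Only customers in the system are served. -/
  idle : ∀ x : Traffic 𝓤, x.Valid → ∀ i t, ¬ r.InSystem x i t → r x i t = 0
  /-- The server works at unit speed whenever somebody is in the system. -/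
  work_conserving : ∀ x : Traffic 𝓤, x.Valid → ∀ t, (∃ i, r.InSystem x i t) → ∑' i, r x i t = 1
  /-- The service rates at time `t` depend only on the customers that have arrived by then. -/
  nonanticipating : ∀ x y : Traffic 𝓤, x.Valid → y.Valid → ∀ t, x.AgreeUpTo y t →
    ∀ i, r x i t = r y i t
  /-- A customer who finds the system empty starts the rule afresh. -/
  regenerative : ∀ x : Traffic 𝓤, x.Valid → ∀ m, r.OpensBusyPeriod x m →
    ∀ j t, r x (m + j) (x.arrival m + t) = r (x.restart m) j t

/-- The primitives of an `M/G/1` queue with arrival rate `lam` and service time distribution `G`: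
`ξ n` is the time between the arrivals of customers `n - 1` and `n` (between time `0` and the first
arrival if `n = 0`), `S n` the service time and `U n` the mark of customer `n`. The arrival times
form a Poisson process with intensity `lam`, independent of the i.i.d. pairs `(S n, U n)`. -/
structure IsMG1 {Ω 𝓤 : Type*} [MeasurableSpace Ω] [MeasurableSpace 𝓤] (P : Measure Ω)
    (ξ S : ℕ → Ω → ℝ) (U : ℕ → Ω → 𝓤) (lam : ℝ) (G : Measure ℝ) : Prop where
  lam_pos : 0 < lam
  measurable_gap : ∀ n, Measurable (ξ n)
  measurable_service : ∀ n, Measurable (S n)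
  measurable_mark : ∀ n, Measurable (U n)
  gap_law : ∀ n, P.map (ξ n) = expMeasure lam
  gap_indep : iIndepFun ξ P
  service_law : ∀ n, P.map (S n) = G
  service_pos : ∀ᵐ s ∂G, 0 < s
  customer_ident : ∀ n,
    IdentDistrib (fun ω => (S n ω, U n ω)) (fun ω => (S 0 ω, U 0 ω)) P P
  customer_indep : iIndepFun (fun n ω => (S n ω, U n ω)) P
  gap_customer_indep : IndepFun (fun ω n => ξ n ω) (fun ω n => (S n ω, U n ω)) P

/-- The traffic with interarrival times `ξ`, service times `S` and marks `U`. -/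
def mg1Traffic {Ω 𝓤 : Type*} (ξ S : ℕ → Ω → ℝ) (U : ℕ → Ω → 𝓤) (ω : Ω) : Traffic 𝓤 :=
  fun n => (∑ k ∈ Finset.range (n + 1), ξ k ω, S n ω, U n ω)

end

noncomputable section

/-! ### Infinite direct sums -/

namespace FinPerm

/-! The proof rests on regeneration at the openings of busy periods. When customer `m` finds the
system empty, all earlier customers have left, and every later one leaves strictly after `m`
arrives. Hence the departure ranks split at `m`: earlier ranks never change again, and later ranks
are `m` plus the ranks in the restarted queue. The permutation is thus a direct sum of one block per
busy period, and `queuePerm` stabilizes on each finite set of completed blocks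
(`partialSum_firstBlock`, `tendstoProjective_queuePerm`).

Where the busy periods end does not depend on the discipline. By work conservation the first one
ends at the first `n` for which the work of customers `0, …, n` fits before the arrival of customer
`n + 1` (`departure_le_of_busy`, `exists_inSystem`). Such an `n` exists almost surely after every
restart: by the strong law, elapsed time minus work brought tends to infinity when `ρ < 1`.

For the i.i.d. property, the queue is coded by the i.i.d. sequence of triples (gap to the next
arrival, service, mark). As the discipline is nonanticipating, the event that the first block equals
`ψ` is decided, up to a null set, by the first `|ψ|` triples, and on it the next cycle starts at
triple `|ψ|`. So the first block is independent of the remaining sequence, which has the original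
law (`measure_firstBlock_inter_nextCycle`); iterating gives i.i.d. blocks. The limit is defined as
the direct sum of these very blocks. -/

theorem oplus_apply_castAdd (σ τ : FinPerm) (p : Fin σ.size) :
    (σ.oplus τ).toPerm (Fin.castAdd τ.size p) = Fin.castAdd τ.size (σ.toPerm p) := by
  change finSumFinEquiv (Equiv.Perm.sumCongr σ.toPerm τ.toPerm
    (finSumFinEquiv.symm (Fin.castAdd τ.size p))) = _
  rw [finSumFinEquiv_symm_apply_castAdd]
  rfl

theorem oplus_apply_natAdd (σ τ : FinPerm) (p : Fin τ.size) :
    (σ.oplus τ).toPerm (Fin.natAdd σ.size p) = Fin.natAdd σ.size (τ.toPerm p) := by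
  change finSumFinEquiv (Equiv.Perm.sumCongr σ.toPerm τ.toPerm
    (finSumFinEquiv.symm (Fin.natAdd σ.size p))) = _
  rw [finSumFinEquiv_symm_apply_natAdd]
  rfl

theorem oplus_apply_of_lt (σ τ : FinPerm) {p : ℕ} (hp : p < σ.size)
    (hp' : p < (σ.oplus τ).size) :
    ((σ.oplus τ).toPerm ⟨p, hp'⟩ : ℕ) = σ.toPerm ⟨p, hp⟩ :=
  congrArg Fin.val (oplus_apply_castAdd σ τ ⟨p, hp⟩)

theorem oplus_apply_add (σ τ : FinPerm) {p : ℕ} (hp : p < τ.size)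
    (hp' : σ.size + p < (σ.oplus τ).size) :
    ((σ.oplus τ).toPerm ⟨σ.size + p, hp'⟩ : ℕ) = σ.size + τ.toPerm ⟨p, hp⟩ :=
  congrArg Fin.val (oplus_apply_natAdd σ τ ⟨p, hp⟩)

theorem size_partialSum_strictMono (ψ : ℕ → FinPerm) :
    StrictMono fun b => (partialSum ψ b).size :=
  strictMono_nat_of_lt_succ fun b => Nat.lt_add_of_pos_right (ψ (b + 1)).size_pos

theorem partialSum_apply_of_le (ψ : ℕ → FinPerm) {b c : ℕ} (hbc : b ≤ c) {p : ℕ}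
    (hp : p < (partialSum ψ b).size) (hp' : p < (partialSum ψ c).size) :
    ((partialSum ψ c).toPerm ⟨p, hp'⟩ : ℕ) = (partialSum ψ b).toPerm ⟨p, hp⟩ := by
  induction c, hbc using Nat.le_induction with
  | base => rfl
  | succ c hbc ih =>
    have h := hp.trans_le ((size_partialSum_strictMono ψ).monotone hbc)
    rw [← ih h]
    exact oplus_apply_of_lt _ _ h _

theorem infiniteSum_eq_partialSum (ψ : ℕ → FinPerm) {b p : ℕ} (hp : p < (partialSum ψ b).size) :
    infiniteSum ψ p = (partialSum ψ b).toPerm ⟨p, hp⟩ := by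
  rcases le_total p b with h | h
  · exact (partialSum_apply_of_le ψ h (lt_size_partialSum ψ p) hp).symm
  · exact partialSum_apply_of_le ψ h hp (lt_size_partialSum ψ p)

theorem infiniteSum_bijective (ψ : ℕ → FinPerm) : Function.Bijective (infiniteSum ψ) := by
  constructor
  · intro p q h
    have hp := lt_size_partialSum ψ p
    have hq := lt_size_partialSum ψ q
    have hp' := hp.trans_le ((size_partialSum_strictMono ψ).monotone (le_max_left p q))
    have hq' := hq.trans_le ((size_partialSum_strictMono ψ).monotone (le_max_right p q))
    rw [infiniteSum_eq_partialSum ψ hp', infiniteSum_eq_partialSum ψ hq'] at h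
    simpa using (partialSum ψ _).toPerm.injective (Fin.ext h)
  · intro v
    refine ⟨(partialSum ψ v).toPerm.symm ⟨v, lt_size_partialSum ψ v⟩, ?_⟩
    rw [infiniteSum_eq_partialSum ψ (b := v) (Fin.is_lt _)]
    simp

/-- The infinite direct sum as a bijection of `ℕ`. -/
def infiniteSumPerm (ψ : ℕ → FinPerm) : Equiv.Perm ℕ :=
  Equiv.ofBijective _ (infiniteSum_bijective ψ)

theorem infiniteSumPerm_apply (ψ : ℕ → FinPerm) (p : ℕ) :
    infiniteSumPerm ψ p = infiniteSum ψ p := rfl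

/-- Permutations which eventually agree with the infinite direct sum on the letters of every finite
partial sum converge to the infinite direct sum in the projective topology. -/
theorem tendstoProjective_infiniteSum (ψ : ℕ → FinPerm) (π : ℕ → FinPerm)
    (h : ∀ b, ∀ᶠ n in atTop, (partialSum ψ b).size ≤ (π n).size ∧
      ∀ p (_ : p < (partialSum ψ b).size) (hp' : p < (π n).size),
        ((π n).toPerm ⟨p, hp'⟩ : ℕ) = infiniteSum ψ p) :
    TendstoProjective π (infiniteSumPerm ψ) := by
  constructor <;> refine tendsto_pi_nhds.2 fun σ => tendsto_const_nhds.congr' ?_ <;>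
    filter_upwards [h σ.size] with n hn
  · have hk := (lt_size_partialSum ψ σ.size).le
    have hk' := hk.trans hn.1
    have key : ∀ a : Fin σ.size,
        ((π n).toPerm (Fin.castLE hk' a) : ℕ) = infiniteSumPerm ψ a := fun a =>
      hn.2 a (a.2.trans_le hk) (a.2.trans_le hk')
    unfold posCode posCodeLim
    congr 1
    simp only [hk', exists_true_left, Fin.lt_def, key]
  · have hk := (lt_size_partialSum ψ σ.size).le
    have hk' := hk.trans hn.1
    have key : ∀ a : Fin σ.size,
        ((π n).toPerm.symm (Fin.castLE hk' a) : ℕ) = (infiniteSumPerm ψ).symm a := by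
      intro a
      -- The value `a` is taken at a position `q` inside the partial sum, where `π n` already agrees
      -- with the infinite sum. So the inverses agree at `a` as well.
      set q := (partialSum ψ σ.size).toPerm.symm ⟨a, a.2.trans_le hk⟩ with hq
      have hqa : infiniteSum ψ q = a := by
        rw [infiniteSum_eq_partialSum ψ q.2, Fin.eta, hq]
        simp
      have h1 : (infiniteSumPerm ψ).symm a = q := by
        rw [Equiv.symm_apply_eq, infiniteSumPerm_apply, hqa]
      have h2 : (π n).toPerm.symm (Fin.castLE hk' a) = ⟨q, q.2.trans_le hn.1⟩ := by
        rw [Equiv.symm_apply_eq]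
        apply Fin.ext
        rw [hn.2 q q.2, hqa]
        rfl
      rw [h1, h2]
    unfold valCode valCodeLim
    congr 1
    simp only [hk', exists_true_left, Fin.lt_def, key]

instance : Countable FinPerm :=
  Function.Injective.countable
    (f := fun σ : FinPerm => (⟨σ.size, σ.toPerm⟩ : Σ n : ℕ, Equiv.Perm (Fin n)))
    fun ⟨_, _, _⟩ ⟨_, _, _⟩ h => by cases h; rfl

instance : DiscreteMeasurableSpace FinPerm := ⟨fun _ => trivial⟩

end FinPerm

/-! ### Ranks -/

open Classical in
/-- The number of indices below `n` that come before `j` in the order given by `y`, where ties are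
broken by the index. -/
def rankCount {α : Type*} [LinearOrder α] (y : ℕ → α) (n j : ℕ) : ℕ :=
  ((Finset.range n).filter fun i => y i < y j ∨ (y i = y j ∧ i < j)).card

/-- One direction is the defining property of `Tuple.sort`; the other follows because the tie-broken
order is asymmetric. -/
theorem rankPerm_lt_iff {α : Type*} [LinearOrder α] {n : ℕ} (y : Fin n → α) (i j : Fin n) :
    rankPerm y i < rankPerm y j ↔ y i < y j ∨ (y i = y j ∧ i < j) := by
  obtain ⟨hm, ht⟩ := Tuple.eq_sort_iff.1 (rfl : Tuple.sort y = Tuple.sort y)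
  have key : ∀ a b : Fin n, a < b → y (Tuple.sort y a) < y (Tuple.sort y b) ∨
      (y (Tuple.sort y a) = y (Tuple.sort y b) ∧ Tuple.sort y a < Tuple.sort y b) := by
    intro a b hab
    rcases (hm hab.le).lt_or_eq with h | h
    · exact Or.inl h
    · exact Or.inr ⟨h, ht a b hab h⟩
  obtain ⟨a, rfl⟩ := (Tuple.sort y).surjective i
  obtain ⟨b, rfl⟩ := (Tuple.sort y).surjective j
  simp only [rankPerm, Equiv.Perm.inv_def, Equiv.symm_apply_apply]
  refine ⟨key a b, fun h => ?_⟩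
  by_contra hab
  rcases (not_lt.1 hab).lt_or_eq with h' | h'
  · rcases key b a h' with h1 | h1 <;> rcases h with h2 | h2
    · exact lt_asymm h1 h2
    · exact h1.ne h2.1.symm
    · exact h2.ne h1.1.symm
    · exact lt_asymm h1.2 h2.2
  · subst h'
    simp at h

theorem connectingPerm_of_strictMono {α β : Type*} [LinearOrder α] [LinearOrder β] {n : ℕ}
    {x : Fin n → α} (hx : StrictMono x) (y : Fin n → β) : connectingPerm x y = rankPerm y := by
  have h : Tuple.sort x = 1 := Tuple.sort_eq_refl_iff_monotone.2 hx.monotone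
  simp [connectingPerm, rankPerm, h]

/-- A rank counts the elements of smaller rank. As a count over `Finset.range n` it can be compared
for different `n` and split at the opening of a busy period. -/
theorem rankPerm_apply {α : Type*} [LinearOrder α] (y : ℕ → α) (n : ℕ) (j : Fin n) :
    (rankPerm (fun i : Fin n => y i) j : ℕ) = rankCount y n j := by
  classical
  have h1 : (rankPerm (fun i : Fin n => y i) j : ℕ)
      = (Finset.univ.filter fun i : Fin n => rankPerm (fun i : Fin n => y i) i
          < rankPerm (fun i : Fin n => y i) j).card := by
    rw [← Fin.card_Iio]
    refine (Finset.card_equiv (rankPerm fun i : Fin n => y i) ?_).symm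
    simp
  rw [h1, rankCount]
  refine Finset.card_bij (fun i _ => (i : ℕ)) ?_ (fun a _ b _ h => Fin.ext h) ?_
  · intro i hi
    rw [Finset.mem_filter, rankPerm_lt_iff] at hi
    exact Finset.mem_filter.2 ⟨Finset.mem_range.2 i.2, hi.2⟩
  · intro i hi
    rw [Finset.mem_filter, Finset.mem_range] at hi
    refine ⟨⟨i, hi.1⟩, ?_, rfl⟩
    rw [Finset.mem_filter, rankPerm_lt_iff]
    exact ⟨Finset.mem_univ _, hi.2⟩

/-! ### Service received and departures -/

theorem ServiceRates.received_mono {𝓤 : Type*} (r : ServiceRates 𝓤) (x : Traffic 𝓤) (i : ℕ) :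
    Monotone (r.received x i) :=
  fun _ _ h => lintegral_mono_set (Set.Iic_subset_Iic.2 h)

namespace IsDiscipline

variable {𝓤 : Type*} [MeasurableSpace 𝓤] {r : ServiceRates 𝓤} {x : Traffic 𝓤}

theorem measurable_rate (hr : IsDiscipline r) (x : Traffic 𝓤) (i : ℕ) : Measurable (r x i) :=
  (hr.measurable i).comp measurable_prodMk_left

theorem rate_eq_zero_of_lt (hr : IsDiscipline r) (hx : x.Valid) {i : ℕ} {t : ℝ}
    (ht : t < x.arrival i) : r x i t = 0 :=
  hr.idle x hx i t fun h => not_le.2 ht h.1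

theorem sum_rate_le_one (hr : IsDiscipline r) (hx : x.Valid) (s : Finset ℕ) (t : ℝ) :
    ∑ i ∈ s, r x i t ≤ 1 := by
  by_cases h : ∃ i, r.InSystem x i t
  · exact (ENNReal.sum_le_tsum s).trans_eq (hr.work_conserving x hx t h)
  · push Not at h
    rw [Finset.sum_eq_zero fun i _ => hr.idle x hx i t (h i)]
    exact zero_le_one

theorem rate_le_one (hr : IsDiscipline r) (hx : x.Valid) (i : ℕ) (t : ℝ) : r x i t ≤ 1 := by
  simpa using hr.sum_rate_le_one hx {i} t

theorem received_le_add (hr : IsDiscipline r) (hx : x.Valid) (i : ℕ) {s t : ℝ} (hst : s ≤ t) :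
    r.received x i t ≤ r.received x i s + ENNReal.ofReal (t - s) := by
  unfold ServiceRates.received
  rw [← Set.Iic_union_Ioc_eq_Iic hst]
  refine (lintegral_union_le _ _ _).trans (add_le_add le_rfl ?_)
  calc ∫⁻ u in Set.Ioc s t, r x i u ≤ ∫⁻ _ in Set.Ioc s t, 1 :=
        lintegral_mono fun u => hr.rate_le_one hx i u
    _ = _ := by simp

theorem received_eq_zero (hr : IsDiscipline r) (hx : x.Valid) {i : ℕ} {t : ℝ}
    (ht : t ≤ x.arrival i) : r.received x i t = 0 := by
  unfold ServiceRates.received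
  -- The rate vanishes strictly before the arrival; the instant of arrival is a null set.
  rw [← setLIntegral_congr Iio_ae_eq_Iic,
    setLIntegral_congr_fun (g := fun _ => 0) measurableSet_Iio fun u hu =>
      hr.rate_eq_zero_of_lt hx (lt_of_lt_of_le hu ht)]
  simp

theorem received_ne_top (hr : IsDiscipline r) (hx : x.Valid) (i : ℕ) (t : ℝ) :
    r.received x i t ≠ ⊤ := by
  rcases le_total t (x.arrival i) with h | h
  · simp [hr.received_eq_zero hx h]
  · refine ne_top_of_le_ne_top ?_ (hr.received_le_add hx i h)
    simp [hr.received_eq_zero hx le_rfl]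

theorem continuous_received (hr : IsDiscipline r) (hx : x.Valid) (i : ℕ) :
    Continuous fun t => (r.received x i t).toReal := by
  refine (LipschitzWith.of_le_add fun s t => ?_).continuous
  rcases le_total s t with h | h
  · have := ENNReal.toReal_mono (hr.received_ne_top hx i t) (r.received_mono x i h)
    linarith [dist_nonneg (x := s) (y := t)]
  · have h1 := ENNReal.toReal_mono
      (ENNReal.add_ne_top.2 ⟨hr.received_ne_top hx i t, ENNReal.ofReal_ne_top⟩)
      (hr.received_le_add hx i h)
    rw [ENNReal.toReal_add (hr.received_ne_top hx i t) ENNReal.ofReal_ne_top,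
      ENNReal.toReal_ofReal (sub_nonneg.2 h)] at h1
    rwa [Real.dist_eq, abs_of_nonneg (sub_nonneg.2 h)]

/-- The infimum is attained: the service received is nondecreasing and grows at speed at most one,
so a deficit at time `t` stays positive for a while after `t`. -/
theorem departure_le_iff (hr : IsDiscipline r) (hx : x.Valid) (i : ℕ) (t : ℝ) :
    r.departure x i ≤ t ↔
      x.arrival i ≤ t ∧ ENNReal.ofReal (x.service i) ≤ r.received x i t := by
  refine ⟨fun h => ?_, fun h => sInf_le ⟨t, h, rfl⟩⟩
  by_contra hc
  have key : ∃ c : ℝ, t < c ∧ ∀ u, x.arrival i ≤ u →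
      ENNReal.ofReal (x.service i) ≤ r.received x i u → c ≤ u := by
    by_cases ha : x.arrival i ≤ t
    · have hs : r.received x i t < ENNReal.ofReal (x.service i) :=
        not_le.1 fun h' => hc ⟨ha, h'⟩
      have hs' := (ENNReal.lt_ofReal_iff_toReal_lt (hr.received_ne_top hx i t)).1 hs
      -- The deficit at time `t` needs at least that much further time.
      refine ⟨t + (x.service i - (r.received x i t).toReal), by linarith, fun u _ hu => ?_⟩
      have htu : t ≤ u := by
        by_contra h'
        exact absurd (hu.trans (r.received_mono x i (not_le.1 h').le)) (not_le.2 hs)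
      have h1 := ENNReal.toReal_mono
        (ENNReal.add_ne_top.2 ⟨hr.received_ne_top hx i t, ENNReal.ofReal_ne_top⟩)
        (hu.trans (hr.received_le_add hx i htu))
      rw [ENNReal.toReal_add (hr.received_ne_top hx i t) ENNReal.ofReal_ne_top,
        ENNReal.toReal_ofReal (sub_nonneg.2 htu), ENNReal.toReal_ofReal (hx.service_pos i).le] at h1
      linarith
    · exact ⟨x.arrival i, not_le.1 ha, fun u hu _ => hu⟩
  obtain ⟨c, htc, hcu⟩ := key
  have : (c : EReal) ≤ r.departure x i := by
    refine le_sInf ?_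
    rintro _ ⟨u, ⟨h1, h2⟩, rfl⟩
    exact EReal.coe_le_coe_iff.2 (hcu u h1 h2)
  exact absurd (this.trans h) (not_le.2 (EReal.coe_lt_coe_iff.2 htc))

theorem inSystem_iff (hr : IsDiscipline r) (hx : x.Valid) (i : ℕ) (t : ℝ) :
    r.InSystem x i t ↔
      x.arrival i ≤ t ∧ r.received x i t < ENNReal.ofReal (x.service i) := by
  unfold ServiceRates.InSystem
  rw [← not_le, hr.departure_le_iff hx, not_and, ← not_le]
  tauto

theorem arrival_lt_departure (hr : IsDiscipline r) (hx : x.Valid) (i : ℕ) :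
    (x.arrival i : EReal) < r.departure x i := by
  rw [← not_le, hr.departure_le_iff hx, hr.received_eq_zero hx le_rfl]
  simpa using hx.service_pos i

/-- By continuity an overshoot would pass through a time `d` of exact fulfilment; after `d` the
customer is gone and is served at rate zero. -/
theorem received_le_service (hr : IsDiscipline r) (hx : x.Valid) (i : ℕ) (t : ℝ) :
    r.received x i t ≤ ENNReal.ofReal (x.service i) := by
  by_contra hlt
  rw [not_le] at hlt
  have hat : x.arrival i ≤ t := by
    by_contra h'
    simp [hr.received_eq_zero hx (not_le.1 h').le] at hlt
  obtain ⟨d, hd, hds⟩ : x.service i ∈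
      (fun t => (r.received x i t).toReal) '' Set.Icc (x.arrival i) t := by
    refine intermediate_value_Icc hat (hr.continuous_received hx i).continuousOn ⟨?_, ?_⟩
    · simpa [hr.received_eq_zero hx le_rfl] using (hx.service_pos i).le
    · exact ((ENNReal.ofReal_lt_iff_lt_toReal (hx.service_pos i).le
        (hr.received_ne_top hx i t)).1 hlt).le
  have hds' : r.received x i d = ENNReal.ofReal (x.service i) := by
    rw [← hds, ENNReal.ofReal_toReal (hr.received_ne_top hx i d)]
  have : r.received x i t ≤ r.received x i d := by
    unfold ServiceRates.received
    rw [← Set.Iic_union_Ioc_eq_Iic hd.2]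
    refine (lintegral_union_le _ _ _).trans ?_
    rw [setLIntegral_congr_fun (g := fun _ => 0) measurableSet_Ioc fun u hu => ?_]
    · simp
    · refine hr.idle x hx i u fun h => ?_
      rw [hr.inSystem_iff hx, ← hds'] at h
      exact absurd (r.received_mono x i hu.1.le) (not_le.2 h.2)
  exact absurd (this.trans_eq hds') (not_le.2 hlt)

theorem sum_received (hr : IsDiscipline r) (x : Traffic 𝓤) (n : ℕ) (t : ℝ) :
    ∑ i ∈ Finset.range n, r.received x i t =
      ∫⁻ u in Set.Iic t, ∑ i ∈ Finset.range n, r x i u :=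
  (lintegral_finsetSum _ fun i _ => hr.measurable_rate x i).symm

theorem sum_received_le (hr : IsDiscipline r) (hx : x.Valid) (n : ℕ) (t : ℝ) :
    ∑ i ∈ Finset.range n, r.received x i t ≤ ENNReal.ofReal (t - x.arrival 0) := by
  rw [hr.sum_received]
  calc ∫⁻ u in Set.Iic t, ∑ i ∈ Finset.range n, r x i u
      ≤ ∫⁻ u in Set.Iic t, (Set.Ici (x.arrival 0)).indicator 1 u := by
        refine lintegral_mono fun u => ?_
        by_cases hu : x.arrival 0 ≤ u
        · simpa [hu] using hr.sum_rate_le_one hx _ u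
        · rw [Finset.sum_eq_zero fun i _ => hr.rate_eq_zero_of_lt hx
            ((not_le.1 hu).trans_le (hx.arrival_strictMono.monotone i.zero_le))]
          exact zero_le
    _ = _ := by
        rw [lintegral_indicator_one measurableSet_Ici, Measure.restrict_apply measurableSet_Ici,
          Set.Ici_inter_Iic, Real.volume_Icc]

/-- Somebody is in the system as long as the work brought by the customers who have arrived exceeds
the time elapsed since the first arrival. -/
theorem exists_inSystem (hr : IsDiscipline r) (hx : x.Valid) {k : ℕ} {t : ℝ}
    (hk : x.arrival k ≤ t)
    (ht : t - x.arrival 0 < ∑ i ∈ Finset.range (k + 1), x.service i) :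
    ∃ i < k + 1, r.InSystem x i t := by
  by_contra! hc
  -- If all these customers were gone, they would have received more work in total than a unit-speed
  -- server can do in the time elapsed.
  have h : ∀ i ∈ Finset.range (k + 1), ENNReal.ofReal (x.service i) ≤ r.received x i t := by
    intro i hi
    have hi' := Finset.mem_range.1 hi
    by_contra h'
    refine hc i hi' ((hr.inSystem_iff hx i t).2 ⟨?_, not_le.1 h'⟩)
    exact (hx.arrival_strictMono.monotone (Nat.lt_succ_iff.1 hi')).trans hk
  have h1 := (Finset.sum_le_sum h).trans (hr.sum_received_le hx _ t)
  rw [← ENNReal.ofReal_sum_of_nonneg fun i _ => (hx.service_pos i).le,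
    ENNReal.ofReal_le_ofReal_iff] at h1
  · exact absurd h1 (not_le.2 ht)
  · exact sub_nonneg.2 ((hx.arrival_strictMono.monotone k.zero_le).trans hk)

/-- If the work of customers `0, …, N` keeps the server busy until it is completed at the latest
when customer `N + 1` arrives, then these customers have left by then. -/
theorem departure_le_of_busy (hr : IsDiscipline r) (hx : x.Valid) {N : ℕ}
    (hbusy : ∀ k < N, x.arrival (k + 1) - x.arrival 0 < ∑ i ∈ Finset.range (k + 1), x.service i)
    (hend : ∑ i ∈ Finset.range (N + 1), x.service i ≤ x.arrival (N + 1) - x.arrival 0)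
    {i : ℕ} (hi : i < N + 1) : r.departure x i ≤ x.arrival (N + 1) := by
  set T := x.arrival 0 + ∑ i ∈ Finset.range (N + 1), x.service i with hT
  have hTa : T ≤ x.arrival (N + 1) := by linarith
  have hmono := hx.arrival_strictMono.monotone
  have hsys : ∀ t ∈ Set.Ico (x.arrival 0) T, ∃ i, r.InSystem x i t := by
    intro t ht
    classical
    -- Customer `k` is the last among `0, …, N` to have arrived by time `t`; the work brought so far
    -- outlasts `t`, by `hbusy` if `k < N` and by `t < T` if `k = N`.
    set k := Nat.findGreatest (fun k => x.arrival k ≤ t) N with hkdef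
    have hk : x.arrival k ≤ t :=
      Nat.findGreatest_spec (P := fun k => x.arrival k ≤ t) (Nat.zero_le N) ht.1
    have hkN : k ≤ N := Nat.findGreatest_le N
    obtain ⟨i, -, hi⟩ := hr.exists_inSystem hx (k := k) hk (by
      rcases hkN.eq_or_lt with h | h
      · rw [h]
        linarith [ht.2]
      · have := not_le.1 (Nat.findGreatest_is_greatest (P := fun k => x.arrival k ≤ t)
          (Nat.lt_succ_self k) h)
        have h2 := hbusy k h
        simp only [Nat.succ_eq_add_one] at this
        linarith)
    exact ⟨i, hi⟩
  -- The server works at full speed on `[x.arrival 0, T)`, and only customers `0, …, N` have arrived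
  -- in that interval.
  have hge : ENNReal.ofReal (T - x.arrival 0) ≤
      ∑ i ∈ Finset.range (N + 1), r.received x i T := by
    rw [hr.sum_received, ← setLIntegral_congr Iio_ae_eq_Iic]
    calc ENNReal.ofReal (T - x.arrival 0)
        = ∫⁻ _ in Set.Ico (x.arrival 0) T, 1 := by simp
      _ ≤ ∫⁻ u in Set.Ico (x.arrival 0) T, ∑ i ∈ Finset.range (N + 1), r x i u := by
          refine setLIntegral_mono' measurableSet_Ico fun u hu => ?_
          rw [← hr.work_conserving x hx u (hsys u hu), tsum_eq_sum]
          intro i hi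
          refine hr.rate_eq_zero_of_lt hx ((hu.2.trans_le hTa).trans_le (hmono ?_))
          simpa using hi
      _ ≤ _ := lintegral_mono_set fun u hu => hu.2
  -- Nobody receives more than required, and the total received equals the total required; hence
  -- nobody has received less.
  have hfull : ENNReal.ofReal (x.service i) ≤ r.received x i T := by
    by_contra hlt
    rw [not_le, ENNReal.lt_ofReal_iff_toReal_lt (hr.received_ne_top hx i T)] at hlt
    have h1 : ∑ i ∈ Finset.range (N + 1), (r.received x i T).toReal <
        ∑ i ∈ Finset.range (N + 1), x.service i :=
      Finset.sum_lt_sum (fun j _ => ENNReal.toReal_le_of_le_ofReal (hx.service_pos j).le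
        (hr.received_le_service hx j T)) ⟨i, Finset.mem_range.2 hi, hlt⟩
    have h2 := ENNReal.toReal_mono
      (ENNReal.sum_ne_top.2 fun i _ => hr.received_ne_top hx i T) hge
    rw [ENNReal.toReal_sum fun i _ => hr.received_ne_top hx i T, ENNReal.toReal_ofReal] at h2
    · linarith
    · rw [hT, add_sub_cancel_left]
      exact Finset.sum_nonneg fun i _ => (hx.service_pos i).le
  have haT : x.arrival i ≤ T := by
    by_contra h'
    rw [hr.received_eq_zero hx (not_le.1 h').le] at hfull
    simpa using hfull.trans_lt (ENNReal.ofReal_pos.2 (hx.service_pos i))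
  exact ((hr.departure_le_iff hx i T).2 ⟨haT, hfull⟩).trans (EReal.coe_le_coe_iff.2 hTa)

end IsDiscipline

/-! ### Busy periods -/

namespace Traffic

variable {𝓤 : Type*} {x : Traffic 𝓤}

/-- The index of the last customer in the first busy period: the first `n` such that the work of
customers `0, …, n` can be completed before the next arrival. -/
def lastIndex (x : Traffic 𝓤) : ℕ :=
  sInf {n | ∑ i ∈ Finset.range (n + 1), x.service i ≤ x.arrival (n + 1) - x.arrival 0}

/-- The index of the customer who opens busy period `i`. -/
def blockStart (x : Traffic 𝓤) : ℕ → ℕ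
  | 0 => 0
  | i + 1 => blockStart x i + ((x.restart (blockStart x i)).lastIndex + 1)

theorem blockStart_succ (x : Traffic 𝓤) (i : ℕ) :
    x.blockStart (i + 1) = x.blockStart i + ((x.restart (x.blockStart i)).lastIndex + 1) := rfl

/-- Valid traffic for which the work brought is eventually dominated by the time elapsed. -/
structure Stable (x : Traffic 𝓤) : Prop extends x.Valid where
  tendsto_slack :
    Tendsto (fun n => x.arrival n - ∑ i ∈ Finset.range n, x.service i) atTop atTop

theorem arrival_restart (x : Traffic 𝓤) (m j : ℕ) :
    (x.restart m).arrival j = x.arrival (m + j) - x.arrival m := rfl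

theorem service_restart (x : Traffic 𝓤) (m j : ℕ) :
    (x.restart m).service j = x.service (m + j) := rfl

theorem restart_restart (x : Traffic 𝓤) (m n : ℕ) :
    (x.restart m).restart n = x.restart (m + n) := by
  funext j
  refine Prod.ext ?_ ?_
  · change x.arrival (m + (n + j)) - x.arrival m - (x.arrival (m + n) - x.arrival m) =
      x.arrival (m + n + j) - x.arrival (m + n)
    rw [add_assoc]
    ring
  · change (x (m + (n + j))).2 = (x (m + n + j)).2
    rw [add_assoc]

theorem Valid.restart (hx : x.Valid) (m : ℕ) : (x.restart m).Valid where
  arrival_nonneg := by simp [arrival_restart]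
  arrival_strictMono i j hij := by
    simp only [arrival_restart]
    linarith [hx.arrival_strictMono (Nat.add_lt_add_left hij m)]
  arrival_tendsto := by
    change Tendsto (fun j => x.arrival (m + j) + -x.arrival m) atTop atTop
    refine tendsto_atTop_add_const_right _ _ ?_
    simpa only [add_comm m] using (tendsto_add_atTop_iff_nat m).2 hx.arrival_tendsto
  service_pos i := hx.service_pos (m + i)

theorem Stable.restart (hx : x.Stable) (m : ℕ) : (x.restart m).Stable where
  toValid := hx.toValid.restart m
  tendsto_slack := by
    have h := tendsto_atTop_add_const_right _
      (∑ i ∈ Finset.range m, x.service i - x.arrival m)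
      ((tendsto_add_atTop_iff_nat m).2 hx.tendsto_slack)
    refine h.congr fun n => ?_
    simp only [arrival_restart, service_restart]
    rw [add_comm n m, Finset.sum_range_add]
    ring

/-- The slack tends to infinity, so the set in `lastIndex` is nonempty and the `sInf` is a genuine
minimum. -/
theorem Stable.lastIndex_spec (hx : x.Stable) :
    ∑ i ∈ Finset.range (x.lastIndex + 1), x.service i ≤
      x.arrival (x.lastIndex + 1) - x.arrival 0 := by
  refine Nat.sInf_mem (s := {n | ∑ i ∈ Finset.range (n + 1), x.service i ≤
    x.arrival (n + 1) - x.arrival 0}) ?_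
  obtain ⟨n, hn⟩ := (((tendsto_add_atTop_iff_nat 1).2 hx.tendsto_slack).eventually_ge_atTop
    (x.arrival 0)).exists
  exact ⟨n, by simp only [Set.mem_ofPred_eq]; linarith⟩

theorem lt_sum_of_lt_lastIndex (x : Traffic 𝓤) {k : ℕ} (hk : k < x.lastIndex) :
    x.arrival (k + 1) - x.arrival 0 < ∑ i ∈ Finset.range (k + 1), x.service i :=
  not_le.1 fun h => Nat.notMem_of_lt_sInf hk h

theorem blockStart_strictMono (x : Traffic 𝓤) : StrictMono x.blockStart :=
  strictMono_nat_of_lt_succ fun i => by simp only [blockStart]; omega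

theorem exists_blockStart_le_lt (x : Traffic 𝓤) (j : ℕ) :
    ∃ i, x.blockStart i ≤ j ∧ j < x.blockStart (i + 1) := by
  induction j with
  | zero => exact ⟨0, le_rfl, by simp [blockStart]⟩
  | succ j ih =>
    obtain ⟨i, h1, h2⟩ := ih
    by_cases h : j + 1 < x.blockStart (i + 1)
    · exact ⟨i, by omega, h⟩
    · have := x.blockStart_strictMono (Nat.lt_succ_self (i + 1))
      exact ⟨i + 1, by omega, by simp only [Nat.succ_eq_add_one] at this; omega⟩

end Traffic

/-- The permutation that connects arrivals and departures in the first busy period. -/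
def ServiceRates.firstBlock {𝓤 : Type*} (r : ServiceRates 𝓤) (x : Traffic 𝓤) : FinPerm :=
  r.queuePerm x x.lastIndex

namespace ServiceRates

variable {𝓤 : Type*} {r : ServiceRates 𝓤} {x : Traffic 𝓤}

theorem departure_le_of_lt (hx : x.Valid) {m i : ℕ} (hm : r.OpensBusyPeriod x m)
    (hi : i < m) : r.departure x i ≤ x.arrival m :=
  not_lt.1 fun h => hm i hi ⟨(hx.arrival_strictMono hi).le, h⟩

theorem queuePerm_apply (hx : x.Valid) {n j : ℕ}
    (hj : j < (r.queuePerm x n).size) :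
    ((r.queuePerm x n).toPerm ⟨j, hj⟩ : ℕ) = rankCount (r.departure x) (n + 1) j := by
  have : (r.queuePerm x n).toPerm = rankPerm fun i : Fin (n + 1) => r.departure x i :=
    connectingPerm_of_strictMono (fun a b h => hx.arrival_strictMono h) _
  rw [this]
  exact rankPerm_apply (r.departure x) (n + 1) ⟨j, hj⟩

end ServiceRates

/-! ### Restarting at the opening of a busy period, and the block structure of the departure ranks
-/

namespace IsDiscipline

variable {𝓤 : Type*} [MeasurableSpace 𝓤] {r : ServiceRates 𝓤} {x : Traffic 𝓤}

/-- The inequality is strict because service times are positive; therefore no tie crosses the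
boundary between busy periods. -/
theorem departure_lt_of_lt_of_le (hr : IsDiscipline r) (hx : x.Valid) {m i j : ℕ}
    (hm : r.OpensBusyPeriod x m) (hi : i < m) (hj : m ≤ j) :
    r.departure x i < r.departure x j :=
  ((ServiceRates.departure_le_of_lt hx hm hi).trans
    (EReal.coe_le_coe_iff.2 (hx.arrival_strictMono.monotone hj))).trans_lt
    (hr.arrival_lt_departure hx j)

theorem received_restart (hr : IsDiscipline r) (hx : x.Valid) {m : ℕ}
    (hm : r.OpensBusyPeriod x m) (j : ℕ) (t : ℝ) :
    r.received x (m + j) (x.arrival m + t) = r.received (x.restart m) j t := by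
  have h := (measurePreserving_add_left volume (x.arrival m)).setLIntegral_comp_preimage
    (measurableSet_Iic (a := x.arrival m + t)) (hr.measurable_rate x (m + j))
  rw [Set.preimage_const_add_Iic, add_sub_cancel_left] at h
  unfold ServiceRates.received
  rw [← h]
  exact lintegral_congr fun u => hr.regenerative x hx m hm j u

theorem departure_restart_le_iff (hr : IsDiscipline r) (hx : x.Valid) {m : ℕ}
    (hm : r.OpensBusyPeriod x m) (j : ℕ) (t : ℝ) :
    r.departure x (m + j) ≤ ((x.arrival m + t : ℝ) : EReal) ↔
      r.departure (x.restart m) j ≤ t := by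
  rw [hr.departure_le_iff hx, hr.departure_le_iff (hx.restart m), hr.received_restart hx hm,
    Traffic.arrival_restart, Traffic.service_restart, sub_le_iff_le_add']

theorem departure_restart_lt_iff (hr : IsDiscipline r) (hx : x.Valid) {m : ℕ}
    (hm : r.OpensBusyPeriod x m) (i j : ℕ) :
    r.departure x (m + i) < r.departure x (m + j) ↔
      r.departure (x.restart m) i < r.departure (x.restart m) j := by
  -- Departure times may be `⊤`. Comparing them through real thresholds avoids shifting extended
  -- reals.
  have key : ∀ a b : EReal, a < b ↔ ∃ t : ℝ, a ≤ t ∧ ¬ b ≤ t := by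
    intro a b
    constructor
    · intro h
      obtain ⟨t, h1, h2⟩ := EReal.lt_iff_exists_real_btwn.1 h
      exact ⟨t, h1.le, not_le.2 h2⟩
    · rintro ⟨t, h1, h2⟩
      exact h1.trans_lt (not_le.1 h2)
  rw [key, key, ← (Equiv.addLeft (x.arrival m)).exists_congr_right]
  simp only [Equiv.coe_addLeft, hr.departure_restart_le_iff hx hm]

theorem departure_restart_eq_iff (hr : IsDiscipline r) (hx : x.Valid) {m : ℕ}
    (hm : r.OpensBusyPeriod x m) (i j : ℕ) :
    r.departure x (m + i) = r.departure x (m + j) ↔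
      r.departure (x.restart m) i = r.departure (x.restart m) j := by
  have h1 := hr.departure_restart_lt_iff hx hm i j
  have h2 := hr.departure_restart_lt_iff hx hm j i
  rw [← not_iff_not, ← ne_eq, ← ne_eq, lt_or_lt_iff_ne.symm, lt_or_lt_iff_ne.symm, h1, h2]

/-- Customers before `m` have left for good when `m` arrives, so only the restarted queue decides
who finds the system empty later. -/
theorem opensBusyPeriod_add_iff (hr : IsDiscipline r) (hx : x.Valid) {m : ℕ}
    (hm : r.OpensBusyPeriod x m) (k : ℕ) :
    r.OpensBusyPeriod x (m + k) ↔ r.OpensBusyPeriod (x.restart m) k := by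
  have key : ∀ i, r.InSystem x (m + i) (x.arrival (m + k)) ↔
      r.InSystem (x.restart m) i ((x.restart m).arrival k) := by
    intro i
    have h := hr.departure_restart_le_iff hx hm i ((x.restart m).arrival k)
    rw [Traffic.arrival_restart, add_sub_cancel] at h
    unfold ServiceRates.InSystem
    rw [← not_le, h, not_le, Traffic.arrival_restart, Traffic.arrival_restart, sub_le_sub_iff_right]
  constructor
  · exact fun h i hi h' => h (m + i) (by omega) ((key i).2 h')
  · intro h i hi h'
    rcases lt_or_ge i m with him | him
    · refine absurd ((ServiceRates.departure_le_of_lt hx hm him).trans (EReal.coe_le_coe_iff.2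
        (hx.arrival_strictMono.monotone (Nat.le_add_right m k)))) (not_le.2 h'.2)
    · obtain ⟨i, rfl⟩ := Nat.exists_eq_add_of_le him
      exact h i (by omega) ((key i).1 h')

theorem departure_le_of_lt_lastIndex_succ (hr : IsDiscipline r) (hx : x.Stable) {i : ℕ}
    (hi : i < x.lastIndex + 1) : r.departure x i ≤ x.arrival (x.lastIndex + 1) :=
  hr.departure_le_of_busy hx.toValid (fun _ hk => x.lt_sum_of_lt_lastIndex hk)
    hx.lastIndex_spec hi

theorem opensBusyPeriod_lastIndex_succ (hr : IsDiscipline r) (hx : x.Stable) :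
    r.OpensBusyPeriod x (x.lastIndex + 1) :=
  fun _ hi h => not_le.2 h.2 (hr.departure_le_of_lt_lastIndex_succ hx hi)

/-- Unfinished work at an arrival means that somebody is present. With
`opensBusyPeriod_lastIndex_succ`, this identifies `lastIndex` with the end of the first busy period
under any discipline. -/
theorem not_opensBusyPeriod (hr : IsDiscipline r) (hx : x.Valid) {k : ℕ} (hk : k < x.lastIndex) :
    ¬ r.OpensBusyPeriod x (k + 1) := by
  obtain ⟨i, hi, h⟩ := hr.exists_inSystem hx (hx.arrival_strictMono (Nat.lt_succ_self k)).le
    (x.lt_sum_of_lt_lastIndex hk)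
  exact fun ho => ho i hi h

theorem opensBusyPeriod_blockStart (hr : IsDiscipline r) (hx : x.Stable) (i : ℕ) :
    r.OpensBusyPeriod x (x.blockStart i) := by
  induction i with
  | zero => exact fun i hi => absurd hi (Nat.not_lt_zero i)
  | succ i ih =>
    exact (hr.opensBusyPeriod_add_iff hx.toValid ih _).2
      (hr.opensBusyPeriod_lastIndex_succ (hx.restart _))

theorem opensBusyPeriod_iff (hr : IsDiscipline r) (hx : x.Stable) (k : ℕ) :
    r.OpensBusyPeriod x k ↔ ∃ i, x.blockStart i = k := by
  constructor
  · intro h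
    obtain ⟨i, h1, h2⟩ := x.exists_blockStart_le_lt k
    refine ⟨i, ?_⟩
    by_contra hne
    obtain ⟨l, rfl⟩ : ∃ l, k = x.blockStart i + (l + 1) :=
      ⟨k - x.blockStart i - 1, by omega⟩
    rw [hr.opensBusyPeriod_add_iff hx.toValid (hr.opensBusyPeriod_blockStart hx i)] at h
    refine hr.not_opensBusyPeriod (hx.restart _).toValid ?_ h
    simp only [Traffic.blockStart] at h2
    omega
  · rintro ⟨i, rfl⟩
    exact hr.opensBusyPeriod_blockStart hx i

theorem busyIndex_eq_iff (hr : IsDiscipline r) (hx : x.Stable) (i j : ℕ) :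
    r.busyIndex x j = i ↔ x.blockStart i ≤ j ∧ j < x.blockStart (i + 1) := by
  classical
  have hmono := x.blockStart_strictMono
  have key : ∀ i, x.blockStart i ≤ j → j < x.blockStart (i + 1) → r.busyIndex x j = i := by
    intro i h1 h2
    -- The openers up to `j`, apart from customer `0`, are exactly those of busy periods `1, …, i`.
    have : ((Finset.Icc 1 j).filter fun m => r.OpensBusyPeriod x m) =
        (Finset.Icc 1 i).image x.blockStart := by
      ext k
      simp only [Finset.mem_filter, Finset.mem_Icc, Finset.mem_image, hr.opensBusyPeriod_iff hx]
      constructor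
      · rintro ⟨⟨hk1, hk2⟩, a, rfl⟩
        refine ⟨a, ⟨?_, ?_⟩, rfl⟩
        · exact Nat.one_le_iff_ne_zero.2 (by rintro rfl; simp [Traffic.blockStart] at hk1)
        · exact Nat.lt_succ_iff.1 (hmono.lt_iff_lt.1 (hk2.trans_lt h2))
      · rintro ⟨a, ⟨ha1, ha2⟩, rfl⟩
        refine ⟨⟨?_, (hmono.monotone ha2).trans h1⟩, a, rfl⟩
        exact ha1.trans (hmono.id_le a)
    unfold ServiceRates.busyIndex
    convert congrArg Finset.card this
    rw [Finset.card_image_of_injective _ hmono.injective]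
    simp
  refine ⟨?_, fun h => key i h.1 h.2⟩
  rintro rfl
  obtain ⟨i, h1, h2⟩ := x.exists_blockStart_le_lt j
  rw [key i h1 h2]
  exact ⟨h1, h2⟩

theorem busyCount_eq (hr : IsDiscipline r) (hx : x.Stable) (i : ℕ) :
    r.busyCount x i = (r.firstBlock (x.restart (x.blockStart i))).size := by
  have : {j | r.busyIndex x j = i} =
      (Finset.Ico (x.blockStart i) (x.blockStart (i + 1)) : Set ℕ) := by
    ext j
    simp [hr.busyIndex_eq_iff hx]
  rw [ServiceRates.busyCount, this, Set.encard_coe_eq_coe_finsetCard, Nat.card_Ico]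
  simp [Traffic.blockStart, ServiceRates.firstBlock, ServiceRates.queuePerm]

/-- Customers from `m` on leave strictly after `j`, so they are never counted. -/
theorem rankCount_departure_of_le (hr : IsDiscipline r) (hx : x.Valid) {m n j : ℕ}
    (hm : r.OpensBusyPeriod x m) (hj : j < m) (hn : m ≤ n) :
    rankCount (r.departure x) n j = rankCount (r.departure x) m j := by
  unfold rankCount
  congr 1
  ext i
  simp only [Finset.mem_filter, Finset.mem_range]
  refine ⟨fun h => ⟨?_, h.2⟩, fun h => ⟨h.1.trans_le hn, h.2⟩⟩
  by_contra hi
  have h1 := hr.departure_lt_of_lt_of_le hx hm hj (not_lt.1 hi)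
  rcases h.2 with h2 | h2
  · exact lt_asymm h1 h2
  · exact h1.ne' h2.1

/-- All `m` earlier customers are counted; among the others the comparisons are those of the
restarted queue. -/
theorem rankCount_departure_add (hr : IsDiscipline r) (hx : x.Valid) {m : ℕ}
    (hm : r.OpensBusyPeriod x m) (n j : ℕ) :
    rankCount (r.departure x) (m + n) (m + j) =
      m + rankCount (r.departure (x.restart m)) n j := by
  classical
  unfold rankCount
  rw [Finset.card_filter, Finset.card_filter, Finset.sum_range_add]
  congr 1
  · rw [Finset.sum_congr rfl fun i hi => if_pos (Or.inl
      (hr.departure_lt_of_lt_of_le hx hm (Finset.mem_range.1 hi) (Nat.le_add_right m j)))]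
    simp
  · simp only [hr.departure_restart_lt_iff hx hm, hr.departure_restart_eq_iff hx hm,
      Nat.add_lt_add_iff_left]

/-- Induction on the number of blocks: `rankCount_departure_of_le` keeps the old blocks, and
`rankCount_departure_add` shifts the new one, as `oplus` does. -/
theorem partialSum_firstBlock (hr : IsDiscipline r) (hx : x.Stable) (b : ℕ) :
    (FinPerm.partialSum (fun i => r.firstBlock (x.restart (x.blockStart i))) b).size =
      x.blockStart (b + 1) ∧
    ∀ j (hj : j < (FinPerm.partialSum
        (fun i => r.firstBlock (x.restart (x.blockStart i))) b).size),
      ((FinPerm.partialSum (fun i => r.firstBlock (x.restart (x.blockStart i))) b).toPerm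
        ⟨j, hj⟩ : ℕ) = rankCount (r.departure x) (x.blockStart (b + 1)) j := by
  have hval : ∀ i j (hj : j < (r.firstBlock (x.restart (x.blockStart i))).size),
      x.blockStart i + ((r.firstBlock (x.restart (x.blockStart i))).toPerm ⟨j, hj⟩ : ℕ) =
        rankCount (r.departure x) (x.blockStart (i + 1)) (x.blockStart i + j) := by
    intro i j hj
    have h : ((r.firstBlock (x.restart (x.blockStart i))).toPerm ⟨j, hj⟩ : ℕ) =
        rankCount (r.departure (x.restart (x.blockStart i)))
          ((x.restart (x.blockStart i)).lastIndex + 1) j :=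
      ServiceRates.queuePerm_apply (hx.restart _).toValid hj
    rw [h, Traffic.blockStart_succ,
      hr.rankCount_departure_add hx.toValid (hr.opensBusyPeriod_blockStart hx i)]
  induction b with
  | zero =>
    refine ⟨by simp [FinPerm.partialSum, ServiceRates.firstBlock, ServiceRates.queuePerm,
      Traffic.blockStart], fun j hj => ?_⟩
    have := hval 0 j hj
    simp only [Traffic.blockStart, zero_add] at this ⊢
    exact this
  | succ b ih =>
    obtain ⟨ih1, ih2⟩ := ih
    have hsize : (FinPerm.partialSum (fun i => r.firstBlock (x.restart (x.blockStart i)))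
        (b + 1)).size = x.blockStart (b + 1 + 1) := by
      exact congrArg (· + (r.firstBlock (x.restart (x.blockStart (b + 1)))).size) ih1
    refine ⟨hsize, fun j hj => ?_⟩
    by_cases h : j < x.blockStart (b + 1)
    · rw [hr.rankCount_departure_of_le hx.toValid (hr.opensBusyPeriod_blockStart hx (b + 1)) h
        (x.blockStart_strictMono (Nat.lt_succ_self _)).le, ← ih2 j (by rw [ih1]; exact h)]
      exact FinPerm.oplus_apply_of_lt _ _ _ _
    · obtain ⟨j, rfl⟩ := Nat.exists_eq_add_of_le (not_lt.1 h)
      have hj' : j < (r.firstBlock (x.restart (x.blockStart (b + 1)))).size := by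
        have h2 := hj
        rw [hsize, Traffic.blockStart_succ x (b + 1)] at h2
        simp only [ServiceRates.firstBlock, ServiceRates.queuePerm]
        omega
      rw [← hval (b + 1) j hj']
      simp only [← ih1]
      exact FinPerm.oplus_apply_add _ _ hj' _

theorem tendstoProjective_queuePerm (hr : IsDiscipline r) (hx : x.Stable) :
    FinPerm.TendstoProjective (r.queuePerm x)
      (FinPerm.infiniteSumPerm fun i => r.firstBlock (x.restart (x.blockStart i))) := by
  refine FinPerm.tendstoProjective_infiniteSum _ _ fun b => ?_
  obtain ⟨h1, h2⟩ := hr.partialSum_firstBlock hx b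
  filter_upwards [eventually_ge_atTop (x.blockStart (b + 1))] with n hn
  refine ⟨by rw [h1]; exact hn.trans n.le_succ, fun p hp hp' => ?_⟩
  rw [FinPerm.infiniteSum_eq_partialSum _ hp, h2 p hp, ServiceRates.queuePerm_apply hx.toValid,
    hr.rankCount_departure_of_le hx.toValid (hr.opensBusyPeriod_blockStart hx (b + 1))
      (by rwa [h1] at hp) (hn.trans n.le_succ)]

end IsDiscipline

/-! ### Independence and the exponential distribution -/

/-- Rectangles form a generating π-system. On them the probability factors first between the two
sequences, then within each. -/
theorem ProbabilityTheory.iIndepFun.prodMk_of_indepFun {Ω ι α β : Type*} [MeasurableSpace Ω]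
    [MeasurableSpace α] [MeasurableSpace β] {P : Measure Ω} {A : ι → Ω → α} {B : ι → Ω → β}
    (hAm : ∀ i, Measurable (A i)) (hBm : ∀ i, Measurable (B i))
    (hA : iIndepFun A P) (hB : iIndepFun B P)
    (hAB : IndepFun (fun ω i => A i ω) (fun ω i => B i ω) P) :
    iIndepFun (fun i ω => (A i ω, B i ω)) P := by
  refine iIndepSets.iIndep (fun i => ((hAm i).prodMk (hBm i)).comap_le)
    (fun i => (fun s => (fun ω => (A i ω, B i ω)) ⁻¹' s) ''
      Set.image2 (· ×ˢ ·) {s : Set α | MeasurableSet s} {t : Set β | MeasurableSet t})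
    (fun i => ?_) (fun i => ?_) ?_
  · exact isPiSystem_prod.comap _
  · rw [← generateFrom_prod, MeasurableSpace.comap_generateFrom]
  · rw [iIndepSets_iff]
    intro s f hf
    have : ∀ i, ∃ (a : Set α) (b : Set β), i ∈ s → MeasurableSet a ∧ MeasurableSet b ∧
        A i ⁻¹' a ∩ B i ⁻¹' b = f i := by
      intro i
      by_cases hi : i ∈ s
      · obtain ⟨_, ⟨a, ha, b, hb, rfl⟩, h⟩ := hf i hi
        exact ⟨a, b, fun _ => ⟨ha, hb, h⟩⟩
      · exact ⟨∅, ∅, fun h => absurd h hi⟩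
    choose a b hab using this
    have h1 := hAB.measure_inter_preimage_eq_mul
      (⋂ i ∈ s, (fun g : ι → α => g i) ⁻¹' a i) (⋂ i ∈ s, (fun g : ι → β => g i) ⁻¹' b i)
      (Finset.measurableSet_biInter _ fun i hi => measurable_pi_apply i (hab i hi).1)
      (Finset.measurableSet_biInter _ fun i hi => measurable_pi_apply i (hab i hi).2.1)
    simp only [Set.preimage_iInter, ← Set.preimage_comp, Function.comp_def] at h1
    have h2 : (⋂ i ∈ s, f i) = (⋂ i ∈ s, A i ⁻¹' a i) ∩ ⋂ i ∈ s, B i ⁻¹' b i := by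
      rw [Set.iInter₂_congr fun i hi => (hab i hi).2.2.symm]
      ext ω
      simp only [Set.mem_iInter, Set.mem_inter_iff, ← forall_and]
    have h3 : ∀ i ∈ s, P (f i) = P (A i ⁻¹' a i) * P (B i ⁻¹' b i) := fun i hi => by
      rw [← (hab i hi).2.2]
      have hi' : IndepFun (A i) (B i) P :=
        hAB.comp (measurable_pi_apply i) (measurable_pi_apply i)
      exact hi'.measure_inter_preimage_eq_mul _ _ (hab i hi).1 (hab i hi).2.1
    rw [h2, Finset.prod_congr rfl h3, Finset.prod_mul_distrib,
      ← hA.measure_inter_preimage_eq_mul s fun i hi => (hab i hi).1,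
      ← hB.measure_inter_preimage_eq_mul s fun i hi => (hab i hi).2.1]
    exact h1

/-- If `Φ` and `T` are independent and `T` preserves the distribution of `Y`, then the sequence
`Φ Y, Φ (T Y), Φ (T (T Y)), …` is independent. -/
theorem ProbabilityTheory.iIndepFun_comp_iterate {Ω X α : Type*} [MeasurableSpace Ω]
    [MeasurableSpace X] [MeasurableSpace α] {P : Measure Ω} [IsProbabilityMeasure P]
    {Y : Ω → X} (hY : Measurable Y) {Φ : X → α} {T : X → X} (hΦ : Measurable Φ)
    (hT : MeasurePreserving T (P.map Y) (P.map Y)) (h : IndepFun Φ T (P.map Y)) :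
    iIndepFun (fun i ω => Φ (T^[i] (Y ω))) P := by
  classical
  have hmeas : ∀ i, Measurable fun y => Φ (T^[i] y) := fun i => hΦ.comp (hT.measurable.iterate i)
  have hprob : IsProbabilityMeasure (P.map Y) := Measure.isProbabilityMeasure_map hY.aemeasurable
  have key : ∀ (n : ℕ) (s : ℕ → Set α), (∀ i, MeasurableSet (s i)) →
      P.map Y (⋂ i ∈ Finset.range n, (fun y => Φ (T^[i] y)) ⁻¹' s i) =
        ∏ i ∈ Finset.range n, P.map Y (Φ ⁻¹' s i) := by
    intro n
    induction n with
    | zero => intro s _; simp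
    | succ n ih =>
      intro s hs
      -- Splitting off the factor with index `0` leaves the `T`-preimage of an event of the same
      -- form with `n` factors.
      have hset : (⋂ i ∈ Finset.range (n + 1), (fun y => Φ (T^[i] y)) ⁻¹' s i) =
          Φ ⁻¹' s 0 ∩ T ⁻¹' ⋂ i ∈ Finset.range n, (fun y => Φ (T^[i] y)) ⁻¹' s (i + 1) := by
        ext y
        simp only [Set.mem_iInter, Finset.mem_range, Set.mem_preimage, Set.mem_inter_iff]
        constructor
        · exact fun hy => ⟨hy 0 n.succ_pos, fun i hi => hy (i + 1) (Nat.succ_lt_succ hi)⟩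
        · rintro ⟨h0, h1⟩ (_ | i) hi
          · exact h0
          · exact h1 i (Nat.lt_of_succ_lt_succ hi)
      have hm : MeasurableSet
          (⋂ i ∈ Finset.range n, (fun y => Φ (T^[i] y)) ⁻¹' s (i + 1)) :=
        Finset.measurableSet_biInter _ fun i _ => hmeas i (hs (i + 1))
      rw [hset, h.measure_inter_preimage_eq_mul _ _ (hs 0) hm,
        hT.measure_preimage hm.nullMeasurableSet, ih _ fun i => hs (i + 1),
        Finset.prod_range_succ', mul_comm]
  rw [iIndepFun_iff_measure_inter_preimage_eq_mul]
  intro S s hs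
  obtain ⟨n, hn⟩ := S.exists_nat_subset_range
  -- Padding with `Set.univ` extends the finite index set to an initial segment.
  set s' : ℕ → Set α := fun i => if i ∈ S then s i else Set.univ with hs'
  have hs'm : ∀ i, MeasurableSet (s' i) := by
    intro i
    simp only [hs']
    split_ifs with hi
    · exact hs i hi
    · exact MeasurableSet.univ
  have h1 := key n s' hs'm
  rw [Measure.map_apply hY (Finset.measurableSet_biInter _ fun i _ => hmeas i (hs'm i))] at h1
  have h2 : ∀ i ∈ S, P ((fun ω => Φ (T^[i] (Y ω))) ⁻¹' s i) = P.map Y (Φ ⁻¹' s' i) := by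
    intro i hi
    rw [← (hT.iterate i).measure_preimage (hΦ (hs'm i)).nullMeasurableSet,
      Measure.map_apply hY ((hT.measurable.iterate i) (hΦ (hs'm i)))]
    simp only [hs', if_pos hi]
    rfl
  rw [Finset.prod_congr rfl h2, Finset.prod_subset hn, ← h1]
  · congr 1
    ext ω
    simp only [Set.mem_iInter, Set.mem_preimage, hs']
    constructor
    · intro hω i _
      split_ifs with hi
      · exact hω i hi
      · trivial
    · intro hω i hi
      simpa [hi] using hω i (hn hi)
  · intro i _ hi
    simp [hs', hi]

theorem expMeasure_eq_withDensity (lam : ℝ) :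
    expMeasure lam = volume.withDensity (exponentialPDF lam) := rfl

theorem integrableOn_id_mul_exp {lam : ℝ} (hlam : 0 < lam) :
    IntegrableOn (fun x : ℝ => x * (lam * Real.exp (-(lam * x)))) (Set.Ioi 0) ∧
      ∫ x in Set.Ioi (0 : ℝ), x * (lam * Real.exp (-(lam * x))) = 1 / lam := by
  have h := Real.integral_rpow_mul_exp_neg_mul_Ioi (a := 2) two_pos hlam
  have h2 : ∫ x in Set.Ioi (0 : ℝ), x * (lam * Real.exp (-(lam * x))) = 1 / lam := by
    have : ∫ x in Set.Ioi (0 : ℝ), x * (lam * Real.exp (-(lam * x))) =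
        ∫ x in Set.Ioi (0 : ℝ), lam * (x ^ ((2 : ℝ) - 1) * Real.exp (-(lam * x))) := by
      refine setIntegral_congr_fun measurableSet_Ioi fun x _ => ?_
      norm_num
      ring
    rw [this, integral_const_mul, h, Real.Gamma_two]
    norm_num
    field_simp
  refine ⟨?_, h2⟩
  -- A non-integrable function has integral zero by convention, so the nonzero value already proves
  -- integrability.
  exact Integrable.of_integral_ne_zero (by rw [h2]; positivity)

theorem id_mul_exponentialPDF {lam : ℝ} (hlam : 0 < lam) :
    (fun x : ℝ => x * (exponentialPDF lam x).toReal) =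
      (Set.Ioi 0).indicator fun x => x * (lam * Real.exp (-(lam * x))) := by
  funext x
  rcases lt_trichotomy x 0 with hx | rfl | hx
  · simp [exponentialPDF_of_neg hx, hx.le]
  · simp
  · rw [exponentialPDF_of_nonneg hx.le, Set.indicator_of_mem (Set.mem_Ioi.2 hx),
      ENNReal.toReal_ofReal (by positivity)]

theorem measurable_exponentialPDF (lam : ℝ) : Measurable (exponentialPDF lam) :=
  (measurable_exponentialPDFReal lam).ennreal_ofReal

theorem integrable_id_expMeasure {lam : ℝ} (hlam : 0 < lam) :
    Integrable (fun x : ℝ => x) (expMeasure lam) := by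
  rw [expMeasure_eq_withDensity, integrable_withDensity_iff (measurable_exponentialPDF lam)
    (ae_of_all _ fun x => ENNReal.ofReal_lt_top), id_mul_exponentialPDF hlam,
    integrable_indicator_iff measurableSet_Ioi]
  exact (integrableOn_id_mul_exp hlam).1

theorem integral_id_expMeasure {lam : ℝ} (hlam : 0 < lam) : ∫ x, x ∂expMeasure lam = 1 / lam := by
  rw [expMeasure_eq_withDensity, integral_withDensity_eq_integral_toReal_smul
    (measurable_exponentialPDF lam) (ae_of_all _ fun x => ENNReal.ofReal_lt_top)]
  simp only [smul_eq_mul, mul_comm (ENNReal.toReal _)]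
  rw [id_mul_exponentialPDF hlam, integral_indicator measurableSet_Ioi]
  exact (integrableOn_id_mul_exp hlam).2

theorem ae_pos_expMeasure (lam : ℝ) : ∀ᵐ x ∂expMeasure lam, 0 < x := by
  rw [expMeasure_eq_withDensity, ae_withDensity_iff (measurable_exponentialPDF lam)]
  filter_upwards [Measure.ae_ne volume (0 : ℝ)] with x hx h
  by_contra hneg
  exact h (exponentialPDF_of_neg (lt_of_le_of_ne (not_lt.1 hneg) hx))

/-- Partial sums of i.i.d. integrable random variables with positive mean tend to infinity. -/
theorem tendsto_sum_atTop_of_integral_pos {Ω : Type*} [MeasurableSpace Ω] {P : Measure Ω}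
    {X : ℕ → Ω → ℝ} (hint : Integrable (X 0) P)
    (hindep : Pairwise (Function.onFun (IndepFun · · P) X))
    (hident : ∀ i, IdentDistrib (X i) (X 0) P P) (hpos : 0 < ∫ ω, X 0 ω ∂P) :
    ∀ᵐ ω ∂P, Tendsto (fun n => ∑ i ∈ Finset.range n, X i ω) atTop atTop := by
  filter_upwards [strong_law_ae_real X hint hindep hident] with ω hω
  refine (hω.pos_mul_atTop hpos tendsto_natCast_atTop_atTop).congr' ?_
  filter_upwards [eventually_ge_atTop 1] with n hn
  have : (n : ℝ) ≠ 0 := by positivity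
  field_simp

/-! ### Measurability of the permutations -/

namespace FinPerm

theorem measurable_partialSum {Ω : Type*} [MeasurableSpace Ω] {Ψ : ℕ → Ω → FinPerm}
    (hΨ : ∀ i, Measurable (Ψ i)) (b : ℕ) :
    Measurable fun ω => partialSum (fun i => Ψ i ω) b := by
  induction b with
  | zero => exact hΨ 0
  | succ b ih =>
    exact (Measurable.of_discrete (f := fun p : FinPerm × FinPerm => p.1.oplus p.2)).comp
      (ih.prodMk (hΨ (b + 1)))

theorem measurable_infiniteSum {Ω : Type*} [MeasurableSpace Ω] {Ψ : ℕ → Ω → FinPerm}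
    (hΨ : ∀ i, Measurable (Ψ i)) (p : ℕ) :
    Measurable fun ω => infiniteSum (fun i => Ψ i ω) p := by
  have h := (Measurable.of_discrete (f := fun σ : FinPerm =>
    if hp : p < σ.size then (σ.toPerm ⟨p, hp⟩ : ℕ) else 0)).comp (measurable_partialSum hΨ p)
  convert h using 1
  funext ω
  simp [lt_size_partialSum, infiniteSum]

end FinPerm

/-- The sorting permutation is characterized by finitely many comparisons of coordinates. -/
theorem measurableSet_sort_eq {X α : Type*} [MeasurableSpace X] [LinearOrder α]
    [TopologicalSpace α] [OrderClosedTopology α] [SecondCountableTopology α] [MeasurableSpace α]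
    [OpensMeasurableSpace α] {n : ℕ} {f : X → Fin n → α} (hf : ∀ i, Measurable fun x => f x i)
    (σ : Equiv.Perm (Fin n)) : MeasurableSet {x | Tuple.sort (f x) = σ} := by
  simp only [eq_comm (b := σ), Tuple.eq_sort_iff, Monotone, Function.comp_apply]
  have h1 : ∀ a b, MeasurableSet {x | f x a ≤ f x b} := fun a b => measurableSet_le (hf a) (hf b)
  have h2 : ∀ a b, MeasurableSet {x | f x a = f x b} := fun a b => measurableSet_eq_fun (hf a) (hf b)
  measurability

namespace Traffic

variable {𝓤 : Type*} [MeasurableSpace 𝓤]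

theorem measurable_arrival (i : ℕ) : Measurable fun x : Traffic 𝓤 => x.arrival i := by
  unfold arrival
  fun_prop

theorem measurable_service (i : ℕ) : Measurable fun x : Traffic 𝓤 => x.service i := by
  unfold service
  fun_prop

theorem measurable_lastIndex : Measurable (lastIndex : Traffic 𝓤 → ℕ) := by
  set A : ℕ → Set (Traffic 𝓤) := fun n =>
    {x | ∑ i ∈ Finset.range (n + 1), x.service i ≤ x.arrival (n + 1) - x.arrival 0} with hA
  have hmeas : ∀ n, MeasurableSet (A n) := fun n =>
    measurableSet_le (Finset.measurable_fun_sum _ fun i _ => measurable_service i)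
      ((measurable_arrival _).sub (measurable_arrival _))
  refine measurable_of_Iio fun n => ?_
  -- The second set accounts for the default value `0` of `sInf` on the empty set.
  have : lastIndex ⁻¹' Set.Iio n =
      (⋃ k ∈ Set.Iio n, A k) ∪ ((⋂ k, (A k)ᶜ) ∩ {_x | 0 < n}) := by
    ext x
    simp only [Set.mem_preimage, Set.mem_Iio, Set.mem_union, Set.mem_iUnion, Set.mem_inter_iff,
      Set.mem_iInter, Set.mem_compl_iff, exists_prop]
    constructor
    · intro h
      by_cases hne : {k | x ∈ A k}.Nonempty
      · exact Or.inl ⟨_, h, Nat.sInf_mem hne⟩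
      · exact Or.inr ⟨fun k hk => hne ⟨k, hk⟩, Nat.zero_lt_of_lt h⟩
    · rintro (⟨k, hk, hxk⟩ | ⟨h, hn⟩)
      · exact (Nat.sInf_le (s := {k | x ∈ A k}) hxk).trans_lt hk
      · have : {k | x ∈ A k} = ∅ := Set.eq_empty_of_forall_notMem h
        change sInf {k | x ∈ A k} < n
        rw [this]
        simpa using hn
  rw [this]
  exact (MeasurableSet.biUnion (Set.to_countable _) fun k _ => hmeas k).union
    ((MeasurableSet.iInter fun k => (hmeas k).compl).inter (MeasurableSet.const _))

end Traffic

namespace IsDiscipline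

variable {𝓤 : Type*} [MeasurableSpace 𝓤] {r : ServiceRates 𝓤}

theorem measurable_received (hr : IsDiscipline r) (i : ℕ) (t : ℝ) :
    Measurable fun x => r.received x i t :=
  (hr.measurable i).lintegral_prod_right'

theorem measurable_departure (hr : IsDiscipline r) (i : ℕ) :
    Measurable fun x => r.departure x i := by
  refine measurable_of_Iio fun c => ?_
  -- The conditions on `t` persist at later times, so rational times suffice.
  have : (fun x => r.departure x i) ⁻¹' Set.Iio c = ⋃ q : ℚ, ⋃ _ : ((q : ℝ) : EReal) < c,
      {x | x.arrival i ≤ (q : ℝ)} ∩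
        {x | ENNReal.ofReal (x.service i) ≤ r.received x i q} := by
    ext x
    simp only [Set.mem_preimage, Set.mem_Iio, Set.mem_iUnion, Set.mem_inter_iff, Set.mem_ofPred_eq,
      ServiceRates.departure, sInf_lt_iff, exists_prop]
    constructor
    · rintro ⟨_, ⟨t, ⟨h1, h2⟩, rfl⟩, htc⟩
      obtain ⟨q, hq1, hq2⟩ := EReal.lt_iff_exists_rat_btwn.1 htc
      have htq : t ≤ q := (EReal.coe_lt_coe_iff.1 hq1).le
      exact ⟨q, hq2, h1.trans htq, h2.trans (r.received_mono x i htq)⟩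
    · rintro ⟨q, hq, h⟩
      exact ⟨_, ⟨q, h, rfl⟩, hq⟩
  rw [this]
  exact MeasurableSet.iUnion fun q => MeasurableSet.iUnion fun _ =>
    (measurableSet_le (Traffic.measurable_arrival i) measurable_const).inter
      (measurableSet_le (Traffic.measurable_service i).ennreal_ofReal (hr.measurable_received i q))

theorem measurable_queuePerm (hr : IsDiscipline r) (n : ℕ) :
    Measurable fun x => r.queuePerm x n := by
  refine measurable_to_countable' fun ψ => ?_
  have : (fun x => r.queuePerm x n) ⁻¹' {ψ} =
      ⋃ (σ : Equiv.Perm (Fin (n + 1))), ⋃ (τ : Equiv.Perm (Fin (n + 1))),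
        ⋃ _ : (⟨n + 1, n.succ_pos, τ⁻¹ * (σ⁻¹)⁻¹⟩ : FinPerm) = ψ,
          {x | Tuple.sort (fun i : Fin (n + 1) => x.arrival i) = σ} ∩
            {x | Tuple.sort (fun i : Fin (n + 1) => r.departure x i) = τ} := by
    ext x
    simp only [Set.mem_preimage, Set.mem_singleton_iff, Set.mem_iUnion, Set.mem_inter_iff,
      Set.mem_ofPred_eq, exists_prop]
    constructor
    · exact fun h => ⟨_, _, h, rfl, rfl⟩
    · rintro ⟨_, _, h, rfl, rfl⟩
      exact h
  rw [this]
  exact MeasurableSet.iUnion fun σ => MeasurableSet.iUnion fun τ => MeasurableSet.iUnion fun _ =>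
    (measurableSet_sort_eq (fun i => Traffic.measurable_arrival _) σ).inter
      (measurableSet_sort_eq (fun i => hr.measurable_departure _) τ)

theorem measurable_firstBlock (hr : IsDiscipline r) : Measurable r.firstBlock :=
  (measurable_from_prod_countable_left (f := fun p : Traffic 𝓤 × ℕ => r.queuePerm p.1 p.2)
    fun n => hr.measurable_queuePerm n).comp (measurable_id.prodMk Traffic.measurable_lastIndex)

/-! ### The first busy period depends on its customers only -/

variable {x y : Traffic 𝓤}

/-- If customer `i` left earlier under `x`, then at a time between the two departures both systems
would have given the same service, as the rates agree before `c`. Agreement at `c` itself is not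
needed, since one instant carries no service. -/
theorem departure_le_departure_of_agree (hr : IsDiscipline r) (hx : x.Valid) (hy : y.Valid)
    {c : ℝ} (h : ∀ t < c, x.AgreeUpTo y t) {i : ℕ} (hi : x i = y i)
    (hyc : r.departure y i ≤ c) : r.departure y i ≤ r.departure x i := by
  by_contra! hlt
  obtain ⟨t, h1, h2⟩ := EReal.lt_iff_exists_real_btwn.1 hlt
  refine absurd ?_ (not_le.2 h2)
  have htc : t ≤ c := EReal.coe_le_coe_iff.1 (h2.le.trans hyc)
  have h3 := (hr.departure_le_iff hx i t).1 h1.le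
  have hrec : r.received x i t = r.received y i t := by
    unfold ServiceRates.received
    rw [← setLIntegral_congr Iio_ae_eq_Iic, ← setLIntegral_congr Iio_ae_eq_Iic]
    exact setLIntegral_congr_fun measurableSet_Iio fun u hu =>
      hr.nonanticipating x y hx hy u (h u (lt_of_lt_of_le hu htc)) i
  rw [hr.departure_le_iff hy, ← hrec]
  unfold Traffic.arrival Traffic.service at *
  rwa [← hi]

end IsDiscipline

/-- The test at index `n` involves services up to `n` and arrivals up to `n + 1`; this is why the
arrival time after the block must agree too. -/
theorem Traffic.Stable.lastIndex_congr {𝓤 : Type*} {x y : Traffic 𝓤} (hx : x.Stable)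
    (hy : y.Stable) (h : ∀ j < x.lastIndex + 1, x j = y j)
    (ha : x.arrival (x.lastIndex + 1) = y.arrival (x.lastIndex + 1)) :
    y.lastIndex = x.lastIndex := by
  have harr : ∀ j ≤ x.lastIndex + 1, x.arrival j = y.arrival j := by
    intro j hj
    rcases hj.eq_or_lt with rfl | hj
    · exact ha
    · exact congrArg Prod.fst (h j hj)
  have key : ∀ n ≤ x.lastIndex,
      (∑ i ∈ Finset.range (n + 1), x.service i ≤ x.arrival (n + 1) - x.arrival 0 ↔
        ∑ i ∈ Finset.range (n + 1), y.service i ≤ y.arrival (n + 1) - y.arrival 0) := by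
    intro n hn
    rw [harr (n + 1) (by omega), harr 0 (by omega), Finset.sum_congr rfl fun i hi => ?_]
    exact congrArg (fun p => p.2.1) (h i (by rw [Finset.mem_range] at hi; omega))
  have hle : y.lastIndex ≤ x.lastIndex := Nat.sInf_le ((key _ le_rfl).1 hx.lastIndex_spec)
  exact le_antisymm hle (Nat.sInf_le ((key _ hle).2 hy.lastIndex_spec))

/-- Before the next opener arrives, only customers of the block have come in either traffic, and by
then all of them have left. Nonanticipation thus gives equal departure times. -/
theorem IsDiscipline.firstBlock_congr {𝓤 : Type*} [MeasurableSpace 𝓤] {r : ServiceRates 𝓤}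
    {x y : Traffic 𝓤} (hr : IsDiscipline r) (hx : x.Stable)
    (hy : y.Stable) (h : ∀ j < x.lastIndex + 1, x j = y j)
    (ha : x.arrival (x.lastIndex + 1) = y.arrival (x.lastIndex + 1)) :
    r.firstBlock x = r.firstBlock y := by
  have hL := hx.lastIndex_congr hy h ha
  have hagree : ∀ t < x.arrival (x.lastIndex + 1), x.AgreeUpTo y t := by
    intro t ht j hj
    refine h j ?_
    rcases hj with hj | hj
    · exact hx.arrival_strictMono.lt_iff_lt.1 (hj.trans_lt ht)
    · exact hy.arrival_strictMono.lt_iff_lt.1 (hj.trans_lt (ht.trans_eq ha))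
  have hdep : ∀ i : Fin (x.lastIndex + 1), r.departure x i = r.departure y i := by
    intro i
    refine le_antisymm ?_ ?_
    · refine hr.departure_le_departure_of_agree (c := x.arrival (x.lastIndex + 1))
        hy.toValid hx.toValid (fun t ht j hj => (hagree t ht j hj.symm).symm)
        (h i i.2).symm (hr.departure_le_of_lt_lastIndex_succ hx i.2)
    · refine hr.departure_le_departure_of_agree hx.toValid hy.toValid hagree (h i i.2) ?_
      have := hr.departure_le_of_lt_lastIndex_succ hy (i := i) (by rw [hL]; exact i.2)
      rwa [hL, ← ha] at this
  have harr : ∀ i : Fin (x.lastIndex + 1), x.arrival i = y.arrival i := fun i =>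
    congrArg Prod.fst (h i i.2)
  unfold ServiceRates.firstBlock ServiceRates.queuePerm
  rw [hL]
  simp only [hdep, harr]

/-! ### Traffic that starts at time zero, as a function of the gaps -/

namespace Traffic

variable {𝓤 : Type*}

/-- The traffic that starts at time `0`, where `y n` consists of the time between the arrivals of
customers `n` and `n + 1`, and of the service time and the mark of customer `n`. -/
def ofGaps (y : ℕ → ℝ × ℝ × 𝓤) : Traffic 𝓤 := fun n => (∑ k ∈ Finset.range n, (y k).1, (y n).2)

/-- The sequence of gaps and customers after the first busy period. -/
def nextCycle (y : ℕ → ℝ × ℝ × 𝓤) : ℕ → ℝ × ℝ × 𝓤 := fun n => y ((ofGaps y).lastIndex + 1 + n)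

theorem stable_of_slack {x : Traffic 𝓤} (h0 : 0 ≤ x.arrival 0)
    (harr : ∀ n, x.arrival n < x.arrival (n + 1)) (hS : ∀ n, 0 < x.service n)
    (h : Tendsto (fun n => x.arrival n - ∑ i ∈ Finset.range n, x.service i) atTop atTop) :
    x.Stable where
  arrival_nonneg := h0
  arrival_strictMono := strictMono_nat_of_lt_succ harr
  arrival_tendsto := tendsto_atTop_mono
    (fun _ => sub_le_self _ (Finset.sum_nonneg fun i _ => (hS i).le)) h
  service_pos := hS
  tendsto_slack := h

theorem Stable.of_restart {x : Traffic 𝓤} (h0 : 0 ≤ x.arrival 0) (hx : (x.restart 0).Stable) :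
    x.Stable := by
  have harr : ∀ n, (x.restart 0).arrival n = x.arrival n - x.arrival 0 := fun n => by
    rw [arrival_restart, zero_add]
  have hser : ∀ n, (x.restart 0).service n = x.service n := fun n => by
    rw [service_restart, zero_add]
  refine stable_of_slack h0 (fun n => ?_) (fun n => (hser n) ▸ hx.service_pos n) ?_
  · have := hx.arrival_strictMono (Nat.lt_succ_self n)
    rw [harr, harr] at this
    simpa using this
  · refine (tendsto_atTop_add_const_right _ (x.arrival 0) hx.tendsto_slack).congr fun n => ?_
    simp only [harr, hser]
    ring

theorem stable_ofGaps {y : ℕ → ℝ × ℝ × 𝓤} (hgap : ∀ n, 0 < (y n).1) (hS : ∀ n, 0 < (y n).2.1)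
    (h : Tendsto (fun n => ∑ i ∈ Finset.range n, ((y i).1 - (y i).2.1)) atTop atTop) :
    (ofGaps y).Stable := by
  refine stable_of_slack (by simp [ofGaps, arrival]) (fun n => ?_) hS ?_
  · simp only [ofGaps, arrival, Finset.sum_range_succ]
    linarith [hgap n]
  · simp only [Finset.sum_sub_distrib] at h
    exact h

theorem ofGaps_add (y : ℕ → ℝ × ℝ × 𝓤) (m : ℕ) :
    ofGaps (fun n => y (m + n)) = (ofGaps y).restart m := by
  funext j
  refine Prod.ext ?_ rfl
  change ∑ k ∈ Finset.range j, (y (m + k)).1 =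
    ∑ k ∈ Finset.range (m + j), (y k).1 - ∑ k ∈ Finset.range m, (y k).1
  rw [Finset.sum_range_add]
  ring

/-- Passing to the next cycle of gaps is restarting at the next opener. `x.restart 0` discards the
idle time before the first arrival. -/
theorem iterate_nextCycle {x : Traffic 𝓤} {y : ℕ → ℝ × ℝ × 𝓤} (h : x.restart 0 = ofGaps y)
    (i : ℕ) : ofGaps (nextCycle^[i] y) = x.restart (x.blockStart i) := by
  have h' : ∀ m, ofGaps (fun n => y (m + n)) = x.restart m := fun m => by
    rw [ofGaps_add, ← h, restart_restart, zero_add]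
  rw [← h']
  congr 1
  induction i with
  | zero => simp [blockStart]
  | succ i ih =>
    rw [Function.iterate_succ_apply', ih]
    unfold nextCycle
    simp only [h', blockStart_succ, add_assoc]

/-- The first `k` entries of `y`, followed by unit service times and gaps of length two. -/
def truncate (u : 𝓤) (k : ℕ) (y : ℕ → ℝ × ℝ × 𝓤) : ℕ → ℝ × ℝ × 𝓤 :=
  fun n => if n < k then y n else (2, 1, u)

/-- Each filler customer adds a net slack of `2 - 1 = 1`, so stability holds whatever the first `k`
entries are. -/
theorem stable_ofGaps_truncate {y : ℕ → ℝ × ℝ × 𝓤} (hgap : ∀ n, 0 < (y n).1)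
    (hS : ∀ n, 0 < (y n).2.1) (u : 𝓤) (k : ℕ) : (ofGaps (truncate u k y)).Stable := by
  refine stable_ofGaps (fun n => ?_) (fun n => ?_) ?_
  · unfold truncate
    split_ifs
    · exact hgap n
    · norm_num
  · unfold truncate
    split_ifs
    · exact hS n
    · norm_num
  · rw [← tendsto_add_atTop_iff_nat k]
    refine (tendsto_atTop_add_const_left _ (∑ i ∈ Finset.range k,
      ((truncate u k y i).1 - (truncate u k y i).2.1))
      (tendsto_natCast_atTop_atTop (R := ℝ))).congr fun n => ?_
    rw [add_comm n k, Finset.sum_range_add]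
    simp [truncate]
    ring

variable [MeasurableSpace 𝓤]

theorem measurable_ofGaps : Measurable (ofGaps : (ℕ → ℝ × ℝ × 𝓤) → Traffic 𝓤) := by
  unfold ofGaps
  fun_prop

theorem measurable_nextCycle :
    Measurable (nextCycle : (ℕ → ℝ × ℝ × 𝓤) → ℕ → ℝ × ℝ × 𝓤) :=
  (measurable_from_prod_countable_left
    (f := fun (p : (ℕ → ℝ × ℝ × 𝓤) × ℕ) n => p.1 (p.2 + 1 + n)) fun k =>
      measurable_pi_lambda _ fun n => measurable_pi_apply (k + 1 + n)).comp
    (measurable_id.prodMk (measurable_lastIndex.comp measurable_ofGaps))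

end Traffic

/-- Entry `n` carries the gap after customer `n`, so the entries of the block also fix the arrival
time of the next opener. -/
theorem IsDiscipline.firstBlock_ofGaps_congr {𝓤 : Type*} [MeasurableSpace 𝓤] {r : ServiceRates 𝓤}
    (hr : IsDiscipline r) {y z : ℕ → ℝ × ℝ × 𝓤} (hy : (Traffic.ofGaps y).Stable)
    (hz : (Traffic.ofGaps z).Stable) (h : ∀ n < (r.firstBlock (Traffic.ofGaps y)).size, y n = z n) :
    r.firstBlock (Traffic.ofGaps y) = r.firstBlock (Traffic.ofGaps z) := by
  have hsum : ∀ n ≤ (Traffic.ofGaps y).lastIndex + 1,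
      ∑ k ∈ Finset.range n, (y k).1 = ∑ k ∈ Finset.range n, (z k).1 := fun n hn =>
    Finset.sum_congr rfl fun k hk => by
      rw [h k (lt_of_lt_of_le (Finset.mem_range.1 hk) hn)]
  exact hr.firstBlock_congr hy hz
    (fun j hj => Prod.ext (hsum j hj.le) 
      (show (y j).2 = (z j).2 from congrArg Prod.snd (h j hj))) (hsum _ le_rfl)

/-- The block size acts as a stopping time: whether the first block is `ψ` is decided by `ψ.size`
entries. Truncation makes this an explicit function of those entries. -/
theorem IsDiscipline.firstBlock_truncate_eq_iff {𝓤 : Type*} [MeasurableSpace 𝓤]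
    {r : ServiceRates 𝓤} (hr : IsDiscipline r) {y : ℕ → ℝ × ℝ × 𝓤} (hgap : ∀ n, 0 < (y n).1)
    (hS : ∀ n, 0 < (y n).2.1) (hy : (Traffic.ofGaps y).Stable) (u : 𝓤) (ψ : FinPerm) :
    r.firstBlock (Traffic.ofGaps y) = ψ ↔
      r.firstBlock (Traffic.ofGaps (Traffic.truncate u ψ.size y)) = ψ := by
  have hz := Traffic.stable_ofGaps_truncate hgap hS u ψ.size
  constructor
  · intro h
    rw [← h, eq_comm]
    rw [← h] at hz
    exact hr.firstBlock_ofGaps_congr hy hz fun n hn => (if_pos hn).symm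
  · intro h
    have h2 := hr.firstBlock_ofGaps_congr hz hy fun n hn => if_pos (by rwa [h] at hn)
    rw [← h2, h]

/-! ### Regeneration -/

section Regeneration

variable {𝓤 : Type*} [MeasurableSpace 𝓤] {ν : Measure (ℝ × ℝ × 𝓤)} [IsProbabilityMeasure ν]

theorem Traffic.indepFun_truncate_shift (u : 𝓤) (k : ℕ) :
    IndepFun (Traffic.truncate u k) (fun (y : ℕ → ℝ × ℝ × 𝓤) n => y (k + n))
      (Measure.infinitePi fun _ => ν) := by
  have hind : iIndepFun (fun i (y : ℕ → ℝ × ℝ × 𝓤) => y i) (Measure.infinitePi fun _ => ν) :=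
    iIndepFun_infinitePi (X := fun _ a => a) fun _ => measurable_id
  have h := indep_iSup_of_disjoint (fun i => (measurable_pi_apply i).comap_le) hind
    (S := Set.Iio k) (T := Set.Ici k)
    (Set.disjoint_left.2 fun i hi hi' => not_le.2 (Set.mem_Iio.1 hi) hi')
  refine indep_of_indep_of_le_left (indep_of_indep_of_le_right h ?_) ?_
  · refine Measurable.comap_le ?_
    refine @measurable_pi_lambda _ _ _ (_) _ _ fun n => ?_
    exact (comap_measurable fun y : ℕ → ℝ × ℝ × 𝓤 => y (k + n)).mono
      (le_iSup₂_of_le (k + n) (Set.mem_Ici.2 (Nat.le_add_right k n)) le_rfl) le_rfl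
  · refine Measurable.comap_le ?_
    refine @measurable_pi_lambda _ _ _ (_) _ _ fun n => ?_
    unfold Traffic.truncate
    by_cases hn : n < k
    · simp only [hn, if_true]
      exact (comap_measurable fun y : ℕ → ℝ × ℝ × 𝓤 => y n).mono
        (le_iSup₂_of_le n (Set.mem_Iio.2 hn) le_rfl) le_rfl
    · simp only [hn, if_false]
      exact measurable_const

/-- On the event that the first block is `ψ`, the next cycle is the shift by the fixed number
`ψ.size`. The event depends only on earlier coordinates, and the shift preserves the product
measure. Countability of `FinPerm` then gives all sets `s`. -/
theorem IsDiscipline.measure_firstBlock_inter_nextCycle {r : ServiceRates 𝓤} (hr : IsDiscipline r)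
    (hgood : ∀ᵐ y ∂Measure.infinitePi fun _ : ℕ => ν,
      (∀ n, 0 < (y n).1) ∧ (∀ n, 0 < (y n).2.1) ∧ (Traffic.ofGaps y).Stable)
    {s : Set FinPerm} {B : Set (ℕ → ℝ × ℝ × 𝓤)} (hB : MeasurableSet B) :
    Measure.infinitePi (fun _ => ν)
        ((fun y => r.firstBlock (Traffic.ofGaps y)) ⁻¹' s ∩ Traffic.nextCycle ⁻¹' B) =
      Measure.infinitePi (fun _ => ν) ((fun y => r.firstBlock (Traffic.ofGaps y)) ⁻¹' s) *
        Measure.infinitePi (fun _ => ν) B := by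
  set μ : Measure (ℕ → ℝ × ℝ × 𝓤) := Measure.infinitePi fun _ => ν with hμ
  set Φ : (ℕ → ℝ × ℝ × 𝓤) → FinPerm := fun y => r.firstBlock (Traffic.ofGaps y) with hΦdef
  have hΦ : Measurable Φ := hr.measurable_firstBlock.comp Traffic.measurable_ofGaps
  -- Truncation needs some mark as filler; an almost sure event supplies one.
  obtain ⟨y₀, -⟩ := hgood.exists
  set u := (y₀ 0).2.2
  have hsingle : ∀ ψ : FinPerm, μ (Φ ⁻¹' {ψ} ∩ Traffic.nextCycle ⁻¹' B) = μ (Φ ⁻¹' {ψ}) * μ B := by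
    intro ψ
    have hE : Φ ⁻¹' {ψ} =ᵐ[μ] Traffic.truncate u ψ.size ⁻¹' (Φ ⁻¹' {ψ}) := by
      filter_upwards [hgood] with y hy
      exact propext (hr.firstBlock_truncate_eq_iff hy.1 hy.2.1 hy.2.2 u ψ)
    have hset : Φ ⁻¹' {ψ} ∩ Traffic.nextCycle ⁻¹' B =
        Φ ⁻¹' {ψ} ∩ (fun y n => y (ψ.size + n)) ⁻¹' B := by
      ext y
      refine and_congr_right fun hy => ?_
      have : (Traffic.ofGaps y).lastIndex + 1 = ψ.size := congrArg FinPerm.size hy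
      have hnext : Traffic.nextCycle y = fun n => y (ψ.size + n) := by
        funext n
        rw [Traffic.nextCycle, this]
      rw [Set.mem_preimage, Set.mem_preimage, hnext]
    have hmap : μ.map (fun y n => y (ψ.size + n)) = μ :=
      Measure.map_infinitePi_infinitePi_of_inj (P := fun _ : ℕ => ν) (f := fun n => ψ.size + n)
        (add_right_injective ψ.size)
    have hm : Measurable fun (y : ℕ → ℝ × ℝ × 𝓤) n => y (ψ.size + n) := by fun_prop
    have hEB := measure_congr
      (hE.inter (EventuallyEq.refl (ae μ) ((fun y n => y (ψ.size + n)) ⁻¹' B)))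
    rw [hset, hEB, measure_congr hE,
      (Traffic.indepFun_truncate_shift u ψ.size).measure_inter_preimage_eq_mul _ _
        (hΦ (measurableSet_singleton ψ)) hB, ← Measure.map_apply hm hB, hmap]
  -- Two measures on a countable space that agree on singletons are equal; this replaces a summation
  -- over `ψ`.
  have heq : (μ.restrict (Traffic.nextCycle ⁻¹' B)).map Φ = μ B • μ.map Φ := by
    refine Measure.ext_of_singleton fun ψ => ?_
    rw [Measure.map_apply hΦ (measurableSet_singleton ψ),
      Measure.restrict_apply (hΦ (measurableSet_singleton ψ)), hsingle, Measure.smul_apply,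
      Measure.map_apply hΦ (measurableSet_singleton ψ), smul_eq_mul, mul_comm]
  have hs : MeasurableSet s := MeasurableSet.of_discrete
  have h := congrArg (fun m => m s) heq
  simp only [Measure.smul_apply, smul_eq_mul] at h
  rwa [Measure.map_apply hΦ hs, Measure.map_apply hΦ hs, Measure.restrict_apply (hΦ hs),
    mul_comm] at h

theorem IsDiscipline.measurePreserving_nextCycle {r : ServiceRates 𝓤} (hr : IsDiscipline r)
    (hgood : ∀ᵐ y ∂Measure.infinitePi fun _ : ℕ => ν,
      (∀ n, 0 < (y n).1) ∧ (∀ n, 0 < (y n).2.1) ∧ (Traffic.ofGaps y).Stable) :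
    MeasurePreserving Traffic.nextCycle (Measure.infinitePi fun _ : ℕ => ν)
      (Measure.infinitePi fun _ : ℕ => ν) := by
  refine ⟨Traffic.measurable_nextCycle, Measure.ext fun B hB => ?_⟩
  rw [Measure.map_apply Traffic.measurable_nextCycle hB]
  simpa using hr.measure_firstBlock_inter_nextCycle hgood (s := Set.univ) hB

theorem IsDiscipline.indepFun_firstBlock_nextCycle {r : ServiceRates 𝓤} (hr : IsDiscipline r)
    (hgood : ∀ᵐ y ∂Measure.infinitePi fun _ : ℕ => ν,
      (∀ n, 0 < (y n).1) ∧ (∀ n, 0 < (y n).2.1) ∧ (Traffic.ofGaps y).Stable) :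
    IndepFun (fun y => r.firstBlock (Traffic.ofGaps y)) Traffic.nextCycle
      (Measure.infinitePi fun _ : ℕ => ν) := by
  rw [indepFun_iff_measure_inter_preimage_eq_mul]
  intro s B _ hB
  rw [hr.measure_firstBlock_inter_nextCycle hgood hB,
    (hr.measurePreserving_nextCycle hgood).measure_preimage hB.nullMeasurableSet]

end Regeneration

/-! ### The `M/G/1` queue -/

/-- The time between the arrivals of customers `n` and `n + 1`, the service time and the mark of
customer `n`. -/
def mg1Gaps {Ω 𝓤 : Type*} (ξ S : ℕ → Ω → ℝ) (U : ℕ → Ω → 𝓤) (ω : Ω) : ℕ → ℝ × ℝ × 𝓤 :=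
  fun n => (ξ (n + 1) ω, S n ω, U n ω)

theorem restart_zero_mg1Traffic {Ω 𝓤 : Type*} (ξ S : ℕ → Ω → ℝ) (U : ℕ → Ω → 𝓤) (ω : Ω) :
    (mg1Traffic ξ S U ω).restart 0 = Traffic.ofGaps (mg1Gaps ξ S U ω) := by
  funext j
  refine Prod.ext ?_ ?_
  · change ∑ k ∈ Finset.range (0 + j + 1), ξ k ω - ∑ k ∈ Finset.range (0 + 1), ξ k ω =
      ∑ k ∈ Finset.range j, ξ (k + 1) ω
    rw [zero_add, Finset.sum_range_succ']
    simp
  · change (S (0 + j) ω, U (0 + j) ω) = (S j ω, U j ω)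
    rw [zero_add]

namespace IsMG1

variable {Ω 𝓤 : Type*} [MeasurableSpace Ω] [MeasurableSpace 𝓤] {P : Measure Ω}
  {ξ S : ℕ → Ω → ℝ} {U : ℕ → Ω → 𝓤} {lam : ℝ} {G : Measure ℝ}

theorem measurable_customer (hQ : IsMG1 P ξ S U lam G) (n : ℕ) :
    Measurable fun ω => (S n ω, U n ω) :=
  (hQ.measurable_service n).prodMk (hQ.measurable_mark n)

theorem measurable_mg1Gaps_apply (hQ : IsMG1 P ξ S U lam G) (n : ℕ) :
    Measurable fun ω => mg1Gaps ξ S U ω n :=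
  (hQ.measurable_gap (n + 1)).prodMk (hQ.measurable_customer n)

theorem measurable_mg1Gaps (hQ : IsMG1 P ξ S U lam G) : Measurable (mg1Gaps ξ S U) :=
  measurable_pi_lambda _ hQ.measurable_mg1Gaps_apply

theorem indepFun_gap_customer (hQ : IsMG1 P ξ S U lam G) :
    IndepFun (fun ω n => ξ (n + 1) ω) (fun ω n => (S n ω, U n ω)) P :=
  hQ.gap_customer_indep.comp (φ := fun (a : ℕ → ℝ) n => a (n + 1)) (ψ := id) (by fun_prop)
    measurable_id

theorem ae_gap_pos (hQ : IsMG1 P ξ S U lam G) : ∀ᵐ ω ∂P, ∀ n, 0 < ξ n ω := by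
  refine ae_all_iff.2 fun n => ?_
  have h := ae_pos_expMeasure lam
  rw [← hQ.gap_law n] at h
  exact ae_of_ae_map (hQ.measurable_gap n).aemeasurable h

theorem ae_service_pos (hQ : IsMG1 P ξ S U lam G) : ∀ᵐ ω ∂P, ∀ n, 0 < S n ω := by
  refine ae_all_iff.2 fun n => ?_
  have h := hQ.service_pos
  rw [← hQ.service_law n] at h
  exact ae_of_ae_map (hQ.measurable_service n).aemeasurable h

theorem iIndepFun_mg1Gaps (hQ : IsMG1 P ξ S U lam G) :
    iIndepFun (fun n ω => mg1Gaps ξ S U ω n) P :=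
  iIndepFun.prodMk_of_indepFun (fun n => hQ.measurable_gap (n + 1)) hQ.measurable_customer
    (hQ.gap_indep.precomp (add_left_injective 1)) hQ.customer_indep hQ.indepFun_gap_customer

variable [IsProbabilityMeasure P]

theorem identDistrib_mg1Gaps (hQ : IsMG1 P ξ S U lam G) (n : ℕ) :
    IdentDistrib (fun ω => mg1Gaps ξ S U ω n) (fun ω => mg1Gaps ξ S U ω 0) P P where
  aemeasurable_fst := (hQ.measurable_mg1Gaps_apply n).aemeasurable
  aemeasurable_snd := (hQ.measurable_mg1Gaps_apply 0).aemeasurable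
  map_eq := by
    have h : ∀ n, P.map (fun ω => mg1Gaps ξ S U ω n) =
        (expMeasure lam).prod (P.map fun ω => (S 0 ω, U 0 ω)) := by
      intro n
      have hind : IndepFun (ξ (n + 1)) (fun ω => (S n ω, U n ω)) P :=
        hQ.indepFun_gap_customer.comp (measurable_pi_apply n) (measurable_pi_apply n)
      rw [← hQ.gap_law (n + 1), ← (hQ.customer_ident n).map_eq]
      exact (indepFun_iff_map_prod_eq_prod_map_map (hQ.measurable_gap _).aemeasurable
        (hQ.measurable_customer n).aemeasurable).1 hind
    rw [h n, h 0]

theorem map_mg1Gaps (hQ : IsMG1 P ξ S U lam G) :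
    P.map (mg1Gaps ξ S U) =
      Measure.infinitePi fun _ : ℕ => P.map fun ω => mg1Gaps ξ S U ω 0 := by
  refine (hQ.iIndepFun_mg1Gaps.map_fun_eq_infinitePi_map hQ.measurable_mg1Gaps_apply).trans ?_
  congr 1
  funext n
  exact (hQ.identDistrib_mg1Gaps n).map_eq

/-- The increments are i.i.d. with mean `1 / lam - ∫ s, s ∂G`, which is positive exactly when `ρ <
1`. -/
theorem ae_tendsto_slack (hQ : IsMG1 P ξ S U lam G) (hG : Integrable (fun s : ℝ => s) G)
    (hρ : lam * ∫ s, s ∂G < 1) :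
    ∀ᵐ ω ∂P, Tendsto (fun n => ∑ i ∈ Finset.range n,
      ((mg1Gaps ξ S U ω i).1 - (mg1Gaps ξ S U ω i).2.1)) atTop atTop := by
  have hm : Measurable fun p : ℝ × ℝ × 𝓤 => p.1 - p.2.1 := by fun_prop
  have hξ : Integrable (ξ 1) P := by
    have h := integrable_id_expMeasure hQ.lam_pos
    rw [← hQ.gap_law 1] at h
    exact h.comp_measurable (hQ.measurable_gap 1)
  have hS : Integrable (S 0) P := by
    rw [← hQ.service_law 0] at hG
    exact hG.comp_measurable (hQ.measurable_service 0)
  have hξi : ∫ ω, ξ 1 ω ∂P = 1 / lam := by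
    rw [← integral_id_expMeasure hQ.lam_pos, ← hQ.gap_law 1]
    exact (integral_map (hQ.measurable_gap 1).aemeasurable
      aestronglyMeasurable_id).symm
  have hSi : ∫ ω, S 0 ω ∂P = ∫ s, s ∂G := by
    rw [← hQ.service_law 0]
    exact (integral_map (hQ.measurable_service 0).aemeasurable aestronglyMeasurable_id).symm
  refine tendsto_sum_atTop_of_integral_pos
    (X := fun n ω => (mg1Gaps ξ S U ω n).1 - (mg1Gaps ξ S U ω n).2.1) (hξ.sub hS)
    (fun i j hij => (hQ.iIndepFun_mg1Gaps.indepFun hij).comp hm hm)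
    (fun n => (hQ.identDistrib_mg1Gaps n).comp hm) ?_
  change 0 < ∫ ω, (ξ 1 ω - S 0 ω) ∂P
  rw [integral_sub hξ hS, hξi, hSi, sub_pos, lt_div_iff₀ hQ.lam_pos, mul_comm]
  exact hρ

theorem ae_map_stable (hQ : IsMG1 P ξ S U lam G) (hG : Integrable (fun s : ℝ => s) G)
    (hρ : lam * ∫ s, s ∂G < 1) :
    ∀ᵐ y ∂P.map (mg1Gaps ξ S U), (∀ n, 0 < (y n).1) ∧ (∀ n, 0 < (y n).2.1) ∧
      (Traffic.ofGaps y).Stable := by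
  have hY := hQ.measurable_mg1Gaps.aemeasurable (μ := P)
  have h1 : ∀ᵐ y ∂P.map (mg1Gaps ξ S U), ∀ n, 0 < (y n).1 := by
    refine ae_all_iff.2 fun n => (ae_map_iff hY ?_).2 ?_
    · exact measurableSet_lt measurable_const (by fun_prop)
    · exact hQ.ae_gap_pos.mono fun ω h => h (n + 1)
  have h2 : ∀ᵐ y ∂P.map (mg1Gaps ξ S U), ∀ n, 0 < (y n).2.1 := by
    refine ae_all_iff.2 fun n => (ae_map_iff hY ?_).2 ?_
    · exact measurableSet_lt measurable_const (by fun_prop)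
    · exact hQ.ae_service_pos.mono fun ω h => h n
  have h3 : ∀ᵐ y ∂P.map (mg1Gaps ξ S U), Tendsto (fun n => ∑ i ∈ Finset.range n,
      ((y i).1 - (y i).2.1)) atTop atTop :=
    (ae_map_iff hY (measurableSet_tendsto _ fun n => by fun_prop)).2
      (hQ.ae_tendsto_slack hG hρ)
  filter_upwards [h1, h2, h3] with y h1 h2 h3
  exact ⟨h1, h2, Traffic.stable_ofGaps h1 h2 h3⟩

end IsMG1

end

/-! ### The limit permutation and its blocks -/

theorem mainTheorem4 {Ω 𝓤 : Type*} [MeasurableSpace Ω] [MeasurableSpace 𝓤]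
    (P : Measure Ω) [IsProbabilityMeasure P]
    (ξ S : ℕ → Ω → ℝ) (U : ℕ → Ω → 𝓤) (lam : ℝ) (G : Measure ℝ)
    (hQ : IsMG1 P ξ S U lam G)
    (hG : Integrable (fun s : ℝ => s) G) (hρ : lam * ∫ s, s ∂G < 1)
    (r : ServiceRates 𝓤) (hr : IsDiscipline r) :
    ∃ piLim : Ω → Equiv.Perm ℕ,
      (∀ k, Measurable fun ω => piLim ω k) ∧
      (∀ᵐ ω ∂P, FinPerm.TendstoProjective
        (fun n => r.queuePerm (mg1Traffic ξ S U ω) n) (piLim ω)) ∧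
      ∃ Ψ : ℕ → Ω → FinPerm,
        (∀ i, Measurable (Ψ i)) ∧
        iIndepFun Ψ P ∧
        (∀ i, IdentDistrib (Ψ i) (Ψ 0) P P) ∧
        (∀ i, ∀ᵐ ω ∂P, ((Ψ i ω).size : ℕ∞) = r.busyCount (mg1Traffic ξ S U ω) i) ∧
        IdentDistrib (fun ω => fun k => piLim ω k)
          (fun ω => FinPerm.infiniteSum fun i => Ψ i ω) P P := by
  have hY := hQ.measurable_mg1Gaps
  set ν : Measure (ℝ × ℝ × 𝓤) := P.map fun ω => mg1Gaps ξ S U ω 0 with hν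
  have hνprob : IsProbabilityMeasure ν :=
    Measure.isProbabilityMeasure_map (hQ.measurable_mg1Gaps_apply 0).aemeasurable
  have hmap : P.map (mg1Gaps ξ S U) = Measure.infinitePi fun _ : ℕ => ν := hQ.map_mg1Gaps
  have hmeasΦ : Measurable fun y : ℕ → ℝ × ℝ × 𝓤 => r.firstBlock (Traffic.ofGaps y) :=
    hr.measurable_firstBlock.comp Traffic.measurable_ofGaps
  have hgood : ∀ᵐ y ∂Measure.infinitePi fun _ : ℕ => ν,
      (∀ n, 0 < (y n).1) ∧ (∀ n, 0 < (y n).2.1) ∧ (Traffic.ofGaps y).Stable :=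
    hmap ▸ hQ.ae_map_stable hG hρ
  have hT : MeasurePreserving Traffic.nextCycle (P.map (mg1Gaps ξ S U))
      (P.map (mg1Gaps ξ S U)) := by
    rw [hmap]
    exact hr.measurePreserving_nextCycle hgood
  have hind : IndepFun (fun y => r.firstBlock (Traffic.ofGaps y)) Traffic.nextCycle
      (P.map (mg1Gaps ξ S U)) := by
    rw [hmap]
    exact hr.indepFun_firstBlock_nextCycle hgood
  set Ψ : ℕ → Ω → FinPerm := fun i ω =>
    r.firstBlock (Traffic.ofGaps (Traffic.nextCycle^[i] (mg1Gaps ξ S U ω))) with hΨdef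
  have hΨ : ∀ i, Measurable (Ψ i) := fun i =>
    hmeasΦ.comp ((hT.measurable.iterate i).comp hY)
  -- Almost surely the blocks read off from the iterated cycles are those of the actual busy
  -- periods.
  have hblocks : ∀ᵐ ω ∂P, (mg1Traffic ξ S U ω).Stable ∧ ∀ i, Ψ i ω =
      r.firstBlock ((mg1Traffic ξ S U ω).restart ((mg1Traffic ξ S U ω).blockStart i)) := by
    filter_upwards [ae_of_ae_map hY.aemeasurable (hQ.ae_map_stable hG hρ), hQ.ae_gap_pos]
      with ω h1 h2
    have h3 := restart_zero_mg1Traffic ξ S U ω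
    refine ⟨Traffic.Stable.of_restart ?_ (h3 ▸ h1.2.2), fun i => ?_⟩
    · simpa [mg1Traffic, Traffic.arrival] using (h2 0).le
    · exact congrArg r.firstBlock (Traffic.iterate_nextCycle h3 i)
  -- The limit is the direct sum of the blocks for every `ω`, so the equality in distribution holds
  -- by reflexivity.
  refine ⟨fun ω => FinPerm.infiniteSumPerm fun i => Ψ i ω,
    fun k => FinPerm.measurable_infiniteSum hΨ k, ?_, Ψ, hΨ, ?_, fun i => ?_, fun i => ?_, ?_⟩
  · filter_upwards [hblocks] with ω hω
    simp only [hω.2]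
    exact hr.tendstoProjective_queuePerm hω.1
  · exact iIndepFun_comp_iterate hY hmeasΦ hT hind
  · refine ⟨(hΨ i).aemeasurable, (hΨ 0).aemeasurable, ?_⟩
    have h := (hT.iterate i).map_eq
    calc P.map (Ψ i) = (((P.map (mg1Gaps ξ S U)).map Traffic.nextCycle^[i])).map
          fun y => r.firstBlock (Traffic.ofGaps y) := by
          rw [Measure.map_map (hT.measurable.iterate i) hY,
            Measure.map_map hmeasΦ ((hT.measurable.iterate i).comp hY)]
          rfl
      _ = P.map (Ψ 0) := by
          rw [h, Measure.map_map hmeasΦ hY]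
          rfl
  · filter_upwards [hblocks] with ω hω
    rw [hr.busyCount_eq hω.1, hω.2]
  · exact IdentDistrib.refl
      (measurable_pi_lambda _ fun k => FinPerm.measurable_infiniteSum hΨ k).aemeasurable
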